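/- Let $K$ be a subfield of $\mathbb{C}$, let $A\in K^{n\times n}$, and let $f\in K[\lambda]$ be a monic irreducible polynomial of degree $d$. Assume that $$\chi_A(\lambda)=f(\lambda)^{\bar\ell+k}g(\lambda),\qquad \pi_A(\lambda)=f(\lambda)^{\bar\ell}g(\lambda)$$ for the characteristic polynomial $\chi_A$ and the minimal polynomial $\pi_A$ of $A$, with $\bar\ell\ge 1$, $k\ge 0$, $f\nmid g$ and $g$ square-free in $K[\lambda]$. Assume that for each root $\alpha\in\mathbb{C}$ of $f$ the generalized eigenspace of $A$ for $\alpha$ in $\mathbb{C}^n$ has a basis consisting of one Jordan chain of length $\bar\ell$ and $k$ eigenvectors. Let $\mathcal E$ be a basis of $K^n$. For ${\bm e}\in\mathcal E$ let $\pi_{A,{\bm e}}$ be its minimal annihilating polynomial, i.e. the monic generator of $\{h\in K[\lambda]\mid h(A){\bm e}={\bm 0}\}$, and write $\pi_{A,{\bm e}}=f^{\ell_{\bm e}}g_{\bm e}$ with $f\nmid g_{\bm e}$. Let $r=\#\{{\bm e}\in\mathcal E\mid f \text{ divides } \pi_{A,{\bm e}}\}$. Consider the following algorithm. Input: $A$,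 $f$, $\mathcal E$, the polynomials $\pi_{A,{\bm e}}$ and the matrices $g_{\bm e}(A)$ for ${\bm e}\in\mathcal E$, and the multiplicity $m=\bar\ell+k$ of $f$ in $\chi_A$. The rank of a nonzero vector ${\bm v}$ of $\ker f(A)^{\bar\ell}$ is the least $\ell$ with $f(A)^\ell{\bm v}={\bm 0}$. For a vector ${\bm v}$ put $\mathcal L({\bm v})=({\bm v},A{\bm v},\dots,A^{d-1}{\bm v})$. 0. Calculate $f(A)$. 1. (Krylov generating set.) Find $\ell_{\bm e}$ and $g_{\bm e}$ for ${\bm e}\in\mathcal E$ by trial division of $\pi_{A,{\bm e}}$ by $f$. For $\ell=\bar\ell,\dots,1$ let $\mathcal V^{(\ell)}$ be the collection of the vectors $g_{\bm e}(A){\bm e}$ with $\ell_{\bm e}=\ell$. 2. (Jordan–Krylov elimination.) Remove a vector ${\bm v}$ from $\mathcal V^{(\bar\ell)}$, put $\mathcal B=\{{\bm v}\}$ and $m\gets m-\bar\ell$, and go to 3 if $m=0$. Put $S=[\mathcal L({\bm v})]$ and $W=f(A)^{\bar\ell-1}S$. For $\ell=\bar\ell,\dots,2,1$: as long as $\mathcal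 V^{(\ell)}\neq\emptyset$, remove a vector ${\bm v}$ from it, put ${\bm v}'=f(A)^{\ell-1}{\bm v}$, and reduce the last column of $[W\mid{\bm v}']$ by the other columns to $[W\mid{\bm r}']$, applying the same column operations to $[S\mid{\bm v}]$, with result $[S\mid{\bm r}]$. If ${\bm r}'\ne{\bm 0}$, add ${\bm r}$ to $\mathcal B$ (as a vector of rank $\ell$), put $m\gets m-\ell$, go to 3 if $m=0$, and append the columns $\mathcal L({\bm r})$ to $S$ and $\mathcal L({\bm r}')$ to $W$. If ${\bm r}'={\bm 0}\neq{\bm r}$, add ${\bm r}$ to $\mathcal V^{(\ell')}$, where $\ell'<\ell$ is its rank. At the end of the step for $\ell>1$ replace $S$ by $f(A)S$. Here $W$ is kept in reduced (echelon) form by simultaneous column operations on $W$ and $S$; and each vector ${\bm v}$ of rank $\ell$ in $\mathcal V$, and each column of $S$, is stored together with its images $f(A){\bm v},\dots,f(A)^{\ell-1}{\bm v}$, to which the column operations are applied as well, so that ${\bm v}'$, the rank of ${\bm r}$ and $f(A)S$ are read off from stored vectors. 3. (Jordan chains.) Let $\psi(\mu,\lambda)=\frac{f(\mu)-f(\lambda)}{\mu-\lambda}$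 and let $\psi^{(j)}(\mu,\lambda)$ be its $j$-th power with coefficients in $K[\lambda]$ reduced modulo $f(\lambda)$. Compute $\psi^{(1)},\dots,\psi^{(\bar\ell)}$ successively, and for each ${\bm b}\in\mathcal B$, of rank $\ell$, compute the chain of the vectors ${\bm p}^{(j)}=\psi^{(j)}(A,\lambda E_n)f(A)^{\ell-j}{\bm b}$, $j=\ell,\dots,1$, with entries in $K[\lambda]$, where $E_n$ is the identity matrix. Return the set of these chains. Vectors, matrices and polynomials are represented by all their entries and coefficients, with schoolbook arithmetic. Then there is an absolute constant $C$ such that, for all data as above, the number of arithmetic operations and zero tests in $K$ performed by the algorithm is at most $$C\, d\,n^2\,\bar\ell\,\max\{d,\bar\ell,r\}$$ plus the number of operations performed by the subroutine that calculates $f(A)$ in step 0, whichever subroutine is used. -/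

import Mathlib

open Polynomial

namespace JordanKrylov

/-! ### The machine model: arithmetic programs with zero tests

A program works on register contents of an abstract type `R`, on which it has no operation of its
own.  It can only ask for the constants 0 and 1 (free of charge), for one of the four arithmetic
operations, or for a zero test (cost one each). -/

inductive Op : Type
  | add
  | sub
  | mul
  | div

def Op.eval {K : Type} [Field K] : Op → K → K → K
  | .add, x, y => x + y
  | .sub, x, y => x - y
  | .mul, x, y => x * y
  | .div, x, y => x / y

inductive Arith (R α : Type) : Type
  | done (a : α) : Arith R α
  | lit (isOne : Bool) (next : R → Arith R α) : Arith R α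
  | op (o : Op) (x y : R) (next : R → Arith R α) : Arith R α
  | test (x : R) (next : Bool → Arith R α) : Arith R α

namespace Arith

def bind {R α β : Type} : Arith R α → (α → Arith R β) → Arith R β
  | done a, h => h a
  | lit c next, h => lit c (fun z => bind (next z) h)
  | op o x y next, h => op o x y (fun z => bind (next z) h)
  | test x next, h => test x (fun b => bind (next b) h)

instance instMonad {R : Type} : Monad (Arith R) where
  pure := done
  bind := bind

/-- The result of a program, run in the field `K`. -/
def value {K α : Type} [Field K] [DecidableEq K] : Arith K α → α
  | done a => a
  | lit c next => value (next (if c then 1 else 0))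
  | op o x y next => value (next (o.eval x y))
  | test x next => value (next (decide (x = 0)))

/-- The number of arithmetic operations and zero tests in `K` that a program performs. -/
def cost {K α : Type} [Field K] [DecidableEq K] : Arith K α → ℕ
  | done _ => 0
  | lit c next => cost (next (if c then 1 else 0))
  | op o x y next => cost (next (o.eval x y)) + 1
  | test x next => cost (next (decide (x = 0))) + 1

end Arith

section Programs

variable {R α β : Type} {n d : ℕ}

def zero : Arith R R := .lit false .done
def one : Arith R R := .lit true .done
def add (x y : R) : Arith R R := .op .add x y .done
def sub (x y : R) : Arith R R := .op .sub x y .done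
def mul (x y : R) : Arith R R := .op .mul x y .done
def div (x y : R) : Arith R R := .op .div x y .done
def isZero (x : R) : Arith R Bool := .test x .done

/-! ### Control structures -/

def tabulate : (n : ℕ) → (Fin n → Arith R α) → Arith R (Fin n → α)
  | 0, _ => pure (fun i => i.elim0)
  | n + 1, h => do
    let a ← h 0
    let v ← tabulate n (fun i => h i.succ)
    pure (Fin.cons (α := fun _ => α) a v)

def forEach (h : α → Arith R β) : List α → Arith R (List β)
  | [] => pure []
  | x :: xs => do
    let y ← h x
    let ys ← forEach h xs
    pure (y :: ys)

/-- `[x, h x, h (h x), …]`, with `j` entries. -/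
def iterates (h : α → Arith R α) : (j : ℕ) → α → Arith R (List α)
  | 0, _ => pure []
  | 1, x => pure [x]
  | j + 2, x => do
    let y ← h x
    let ys ← iterates h (j + 1) y
    pure (x :: ys)

/-! ### Vectors and matrices -/

def dot : (n : ℕ) → (Fin n → R) → (Fin n → R) → Arith R R
  | 0, _, _ => zero
  | n + 1, x, y => do
    let p ← mul (x 0) (y 0)
    let s ← dot n (fun i => x i.succ) (fun i => y i.succ)
    add p s

def matVec (M : Matrix (Fin n) (Fin n) R) (v : Fin n → R) : Arith R (Fin n → R) :=
  tabulate n (fun i => dot n (M i) v)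

/-- `x + y` -/
def addVec (x y : Fin n → R) : Arith R (Fin n → R) :=
  tabulate n (fun i => add (x i) (y i))

/-- `x - c y` -/
def subSmul (c : R) (x y : Fin n → R) : Arith R (Fin n → R) :=
  tabulate n (fun i => do
    let p ← mul c (y i)
    sub (x i) p)

def zeroVec (n : ℕ) : Arith R (Fin n → R) := tabulate n (fun _ => zero)

/-- The first index at which a vector is not zero; `none` for the zero vector. -/
def firstNonzero : (n : ℕ) → (Fin n → R) → Arith R (Option (Fin n))
  | 0, _ => pure none
  | n + 1, v => do
    let b ← isZero (v 0)
    if b then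
      let i ← firstNonzero n (fun i => v i.succ)
      pure (i.map Fin.succ)
    else pure (some 0)

/-! ### The input -/

/-- The input.  A monic polynomial `f` of degree `d` is given by its coefficients below the leading
one; the minimal annihilating polynomial `P i` of the `i`-th basis vector `E i` is given by the list
of its coefficients, leading coefficient first; `G i` is the matrix `g_e(A)` for `e = E i`, where
`g_e` is the part of `P i` that is prime to `f`. -/
structure Input (R : Type) (n d : ℕ) where
  A : Matrix (Fin n) (Fin n) R
  f : Fin d → R
  E : Fin n → Fin n → R
  P : Fin n → List R
  G : Fin n → Matrix (Fin n) (Fin n) R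
  m : ℕ

/-! ### The Krylov generating set -/

def subPrefix (q : R) : List R → List R → Arith R (List R)
  | c :: cs, x :: xs => do
    let p ← mul q c
    let y ← sub x p
    let ys ← subPrefix q cs xs
    pure (y :: ys)
  | _, xs => pure xs

/-- Division by a monic polynomial: `lower` are the coefficients of the divisor below the leading
one, in descending order; `steps` is the number of coefficients of the quotient. -/
def divide (lower : List R) : (steps : ℕ) → List R → Arith R (List R × List R)
  | 0, p => pure ([], p)
  | _ + 1, [] => pure ([], [])
  | s + 1, q :: rest => do
    let rest' ← subPrefix q lower rest
    let (quot, rem) ← divide lower s rest'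
    pure (q :: quot, rem)

def allZero : List R → Arith R Bool
  | [] => pure true
  | x :: xs => do
    let b ← isZero x
    if b then allZero xs else pure false

/-- Writes a polynomial `p` as `f ^ ℓ * g` with `f` not dividing `g`, by trial divisions; returns
`ℓ` and `g`.  Each successful division shortens `p`, so that `fuel = p.length` is enough. -/
def splitOff (lower : List R) : (fuel : ℕ) → List R → Arith R (ℕ × List R)
  | 0, p => pure (0, p)
  | fuel + 1, p =>
    if p.length ≤ lower.length then pure (0, p)
    else do
      let (quot, rem) ← divide lower (p.length - lower.length) p
      let b ← allZero rem
      if b then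
        let (l, g) ← splitOff lower fuel quot
        pure (l + 1, g)
      else pure (0, p)

/-- The vectors `g_e(A) e`, for the basis vectors `e` whose minimal annihilating polynomial is
divisible by `f`, each with its rank, the exponent of `f` in that polynomial. -/
def krylovGenerators (inp : Input R n d) : Arith R (List (ℕ × (Fin n → R))) := do
  let lower := (List.ofFn inp.f).reverse
  let vs ← forEach (fun i => do
    let (l, g) ← splitOff lower (inp.P i).length (inp.P i)
    if l = 0 then pure none
    else if g.length ≤ 1 then pure (some (l, inp.E i))
    else
      let v ← matVec (inp.G i) (inp.E i)
      pure (some (l, v))) (List.finRange n)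
  pure (vs.filterMap id)

/-! ### The Jordan-Krylov basis

A vector `v` of rank `ℓ` is kept together with its images `f(A) v, …, f(A)^(ℓ-1) v`, in the list
`[f(A)^(ℓ-1) v, …, f(A) v, v]`, its orbit.  The head of an orbit is the vector `v'` (or the column
of `W`), its last entry is `v` (or the column of `S`), and its length is the rank.  A column
operation is carried out on all entries of the orbits, so that no `f(A)^i v` is computed twice. -/

abbrev Orbit (R : Type) (n : ℕ) : Type := List (Fin n → R)

def orbit (fA : Matrix (Fin n) (Fin n) R) (l : ℕ) (v : Fin n → R) : Arith R (Orbit R n) := do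
  let o ← iterates (matVec fA) l v
  pure o.reverse

/-- A column of `W` with the corresponding column of `S` and the images in between.  The matrix `W`
is kept reduced: each column is nonzero at its pivot, where all later columns of `W` vanish. -/
structure Column (R : Type) (n : ℕ) where
  pivot : Fin n
  orbit : Orbit R n

/-- `u - q c`, for orbits `u` and `c` of the same length -/
def subOrbit (q : R) : Orbit R n → Orbit R n → Arith R (Orbit R n)
  | x :: xs, y :: ys => do
    let z ← subSmul q x y
    let zs ← subOrbit q xs ys
    pure (z :: zs)
  | _, _ => pure []

/-- Simultaneous column reduction of the rightmost column:
`[W | v'] → [W | r']` and `[S | v] → [S | r]`. -/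
def reduceBy : List (Column R n) → Orbit R n → Arith R (Orbit R n)
  | c :: cs, x :: xs =>
    match c.orbit with
    | [] => reduceBy cs (x :: xs)
    | w :: _ => do
      let q ← div (x c.pivot) (w c.pivot)
      let u ← subOrbit q (x :: xs) c.orbit
      reduceBy cs u
  | _, u => pure u

/-- Appends one column to `S` and `W`, after reducing it. -/
def addColumn (cols : List (Column R n)) (u : Orbit R n) : Arith R (List (Column R n)) := do
  let c ← reduceBy cols u
  match c with
  | [] => pure cols
  | w :: _ =>
    let p ← firstNonzero n w
    match p with
    | none => pure cols
    | some p => pure (cols ++ [⟨p, c⟩])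

def addColumns : List (Column R n) → List (Orbit R n) → Arith R (List (Column R n))
  | cols, [] => pure cols
  | cols, u :: us => do
    let cols' ← addColumn cols u
    addColumns cols' us

/-- Appends the columns `r, A r, …, A^(d-1) r` to `S`, and `r', A r', …, A^(d-1) r'` to `W`. -/
def addKrylov (A : Matrix (Fin n) (Fin n) R) (d : ℕ) (cols : List (Column R n)) (u : Orbit R n) :
    Arith R (List (Column R n)) := do
  let us ← iterates (forEach (matVec A)) d u
  addColumns cols us

/-- Removes the leading zero vectors from a list of vectors: the orbit that is left has the
length `rank_f r`. -/
def trim : Orbit R n → Arith R (Orbit R n)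
  | [] => pure []
  | x :: xs => do
    let p ← firstNonzero n x
    match p with
    | none => trim xs
    | some _ => pure (x :: xs)

/-- The basis `B` (vectors with their ranks), the matrices `S` and `W`, the set `V` of the vectors
still to be treated, and `m`. -/
structure State (R : Type) (n : ℕ) where
  B : List (ℕ × (Fin n → R))
  cols : List (Column R n)
  V : List (Orbit R n)
  m : ℕ

/-- The while-loop for the rank `l`; the second argument lists the members of `V` of rank `l`. -/
def whileLoop (A : Matrix (Fin n) (Fin n) R) (d l : ℕ) :
    List (Orbit R n) → State R n → Arith R (State R n)
  | [], st => pure st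
  | v :: vs, st => do
    let u ← reduceBy st.cols v
    let t ← trim u
    if t.length = l then
      -- here `r' ≠ 0`
      let B := st.B ++ (t.getLast?.map (fun r => (l, r))).toList
      if st.m - l = 0 then pure { st with B := B, m := 0 }
      else
        let cols ← addKrylov A d st.cols t
        whileLoop A d l vs { st with B := B, cols := cols, m := st.m - l }
    else if t.length = 0 then
      -- here `r = 0`
      whileLoop A d l vs st
    else
      -- here `r ≠ 0` has the rank `t.length < l`
      whileLoop A d l vs { st with V := st.V ++ [t] }

/-- The for-loop over the ranks `l, l - 1, …, 1`. -/
def forLoop (A : Matrix (Fin n) (Fin n) R) (d : ℕ) :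
    (l : ℕ) → State R n → Arith R (List (ℕ × (Fin n → R)))
  | 0, st => pure st.B
  | l + 1, st => do
    let st' ← whileLoop A d (l + 1) (st.V.filter (fun v => v.length = l + 1))
      { st with V := st.V.filter (fun v => v.length ≠ l + 1) }
    if st'.m = 0 then pure st'.B
    else
      -- `S ← f(A) S`
      forLoop A d l
        { st' with cols := st'.cols.map (fun c => { c with orbit := c.orbit.dropLast }) }

/-- Jordan-Krylov elimination: a Jordan-Krylov basis, each vector with its rank. -/
def jordanKrylovBasis (A fA : Matrix (Fin n) (Fin n) R) (d : ℕ)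
    (V : List (ℕ × (Fin n → R))) (m : ℕ) : Arith R (List (ℕ × (Fin n → R))) :=
  let lmax := (V.map Prod.fst).foldr max 0
  match V.filter (fun v => v.1 = lmax) with
  | [] => pure []
  | v :: vs =>
    if m - lmax = 0 then pure [v]
    else do
      let u ← orbit fA lmax v.2
      let cols ← addKrylov A d [] u
      let os ← forEach (fun w => orbit fA w.1 w.2) (vs ++ V.filter (fun v => v.1 ≠ lmax))
      forLoop A d lmax ⟨[v], cols, os, m - lmax⟩

/-! ### The Jordan chains

An element of `K[λ]` of degree less than `d` is a family of coefficients `Fin d → R`; a polynomial in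
`μ` over `K[λ]` is a list of such families, constant coefficient first. -/

/-- `(λ a + c x) mod f` -/
def shiftAdd (f : Fin d → R) (z : R) (a x : Fin d → R) (c : R) : Arith R (Fin d → R) :=
  tabulate d (fun b => do
    let p ← mul (a ⟨d - 1, Nat.sub_lt (Nat.lt_of_le_of_lt (Nat.zero_le _) b.2) Nat.one_pos⟩) (f b)
    let s ← sub (if (b : ℕ) = 0 then z else a ⟨b - 1, Nat.lt_of_le_of_lt (Nat.sub_le _ _) b.2⟩) p
    let q ← mul c (x b)
    add s q)

def mulModAux (f : Fin d → R) (z : R) (x : Fin d → R) : List R → Arith R (Fin d → R)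
  | [] => zeroVec d
  | c :: cs => do
    let a ← mulModAux f z x cs
    shiftAdd f z a x c

/-- `x y mod f` -/
def mulMod (f x y : Fin d → R) : Arith R (Fin d → R) := do
  let z ← zero
  mulModAux f z x (List.ofFn y)

def addLists : List (Fin d → R) → List (Fin d → R) → Arith R (List (Fin d → R))
  | x :: xs, y :: ys => do
    let z ← addVec x y
    let zs ← addLists xs ys
    pure (z :: zs)
  | [], ys => pure ys
  | xs, [] => pure xs

/-- The product of polynomials in `μ` with coefficients in `K[λ]`, reduced modulo `f(λ)`. -/
def mulPoly (f : Fin d → R) : List (Fin d → R) → List (Fin d → R) → Arith R (List (Fin d → R))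
  | [], _ => pure []
  | c :: cs, q => do
    let t ← forEach (mulMod f c) q
    let rest ← mulPoly f cs q
    let z ← zeroVec d
    addLists t (z :: rest)

/-- `ψ_f(μ, λ) = (f(μ) - f(λ)) / (μ - λ)`; the coefficient of `μ ^ a * λ ^ b` in it is the
coefficient of degree `a + b + 1` in `f`. -/
def psi (f : Fin d → R) : Arith R (List (Fin d → R)) := do
  let z ← zero
  let e ← one
  pure (List.ofFn (fun a : Fin d => fun b : Fin d =>
    if h : (a : ℕ) + b + 1 < d then f ⟨a + b + 1, h⟩
    else if (a : ℕ) + b + 1 = d then e else z))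

/-- `ψ^(1), …, ψ^(l)`, where `ψ^(k)` is the `k`-th power of `ψ_f` reduced modulo `f(λ)`. -/
def psiPowers (f : Fin d → R) (l : ℕ) : Arith R (List (List (Fin d → R))) := do
  let p ← psi f
  iterates (mulPoly f p) l p

/-- `ψ(A, λ E) b`, a vector of `n` polynomials in `λ` of degree less than `d`. -/
def evalPsi (A : Matrix (Fin n) (Fin n) R) :
    List (Fin d → R) → (Fin n → R) → Arith R (Fin n → Fin d → R)
  | [], _ => tabulate n (fun _ => zeroVec d)
  | c :: cs, b => do
    let b' ← matVec A b
    let p ← evalPsi A cs b'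
    tabulate n (fun i => tabulate d (fun j => do
      let q ← mul (c j) (b i)
      add q (p i j)))

/-- The Jordan chain `p^(k), …, p^(1)` of a vector `b` of rank `k`, from `ψ^(k), …, ψ^(1)`. -/
def jordanChain (A fA : Matrix (Fin n) (Fin n) R) :
    List (List (Fin d → R)) → (Fin n → R) → Arith R (List (Fin n → Fin d → R))
  | [], _ => pure []
  | [q], b => do
    let p ← evalPsi A q b
    pure [p]
  | q :: q' :: qs, b => do
    let p ← evalPsi A q b
    let b' ← matVec fA b
    let ps ← jordanChain A fA (q' :: qs) b'
    pure (p :: ps)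

def jordanChains (A fA : Matrix (Fin n) (Fin n) R) (f : Fin d → R) (B : List (ℕ × (Fin n → R))) :
    Arith R (List (List (Fin n → Fin d → R))) := do
  let qs ← psiPowers f ((B.map Prod.fst).foldr max 0)
  forEach (fun b => jordanChain A fA (qs.take b.1).reverse b.2) B

/-! ### The overall algorithm -/

/-- The generalized eigenspace of `A` associated to the roots of `f`, as a list of Jordan chains;
`calcfA` is the subroutine that calculates `f(A)`. -/
def generalizedEigenspace (calcfA : Arith R (Matrix (Fin n) (Fin n) R)) (inp : Input R n d) :
    Arith R (List (List (Fin n → Fin d → R))) := do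
  let fA ← calcfA
  let V ← krylovGenerators inp
  let B ← jordanKrylovBasis inp.A fA d V inp.m
  jordanChains inp.A fA inp.f B

end Programs

/-! ### The mathematical notions in the assumptions -/

/-- `p` is the minimal annihilating polynomial of `u` with respect to `A`: the monic generator of
the ideal of all polynomials `h` with `h(A) u = 0`. -/
def IsMinimalAnnihilating {K : Type} [Field K] {n : ℕ} (A : Matrix (Fin n) (Fin n) K)
    (u : Fin n → K) (p : K[X]) : Prop :=
  p.Monic ∧ ∀ h : K[X], (aeval A h).mulVec u = 0 ↔ p ∣ h

/-- The generalized eigenspace of the complex matrix `M` for `α` has a basis that consists of one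
Jordan chain of length `l` and of `k` eigenvectors. -/
def HasOneChainAndEigenvectors {n : ℕ} (M : Matrix (Fin n) (Fin n) ℂ) (α : ℂ) (l k : ℕ) : Prop :=
  ∃ (u : Fin n → ℂ) (w : Fin k → Fin n → ℂ),
    ((M - Matrix.scalar (Fin n) α) ^ l).mulVec u = 0 ∧
    (∀ j, M.mulVec (w j) = α • w j) ∧
    LinearIndependent ℂ
      (Sum.elim (fun i : Fin l => ((M - Matrix.scalar (Fin n) α) ^ (i : ℕ)).mulVec u) w) ∧
    Submodule.span ℂ (Set.range
      (Sum.elim (fun i : Fin l => ((M - Matrix.scalar (Fin n) α) ^ (i : ℕ)).mulVec u) w)) =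
      Module.End.maxGenEigenspace (Matrix.toLin' M) α

/-- The coefficients of a polynomial, leading coefficient first. -/
noncomputable def coeffList {K : Type} [Field K] (p : K[X]) : List K :=
  ((List.range (p.natDegree + 1)).map p.coeff).reverse

end JordanKrylov

/-! Write N = f(A), d = deg f and U = ker N ∩ im N (`kerRange`). The hypothesis on Jordan chains
forces dim U ≤ d over K (`finrank_kerRange_le`). For a root α of f put q = f / (X - α). If y = N x
lies in U, then q(A) y is killed by A - α and is the image under A - α of q(A)² x, a vector of the
generalized eigenspace; hence it lies on the line of the last vector of the long chain. Expanding
one suitable entry of q(A) y in 1, α, …, α^(d-1), which are independent over K, gives d coordinates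
in K that determine y. As K[A] acts on U through the field K[λ]/(f), each nonzero element then
generates U (`kerRange_le_of_pow_mulVec_mem`).

Consequently, if the first vector treated has rank at least two, its d columns in W already span U.
The head f(A)^(ℓ-1) v of any other orbit of rank ℓ ≥ 2 lies in U and is reduced to zero. So before
rank one S has at most d columns, no further vector enters the basis, and a treated vector returns
at most once, with smaller rank (`whileLoop_of_two_le`, `forLoop_spec`).

This governs the cost. At each of at most l ranks, each of at most r vectors is reduced in O(d l n)
operations. A Krylov block is appended once with long orbits, for O(d l n²), and otherwise, at most
r times, with orbits of length one, for O(d n²) each. Likewise one chain is long, for O(d l² n²),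
and at most r chains have length one (`cost_jordanChains_le`). Trial division costs O(d l n²) and
the powers of ψ cost O(d⁴ l²). Everything fits the bound because d l ≤ n, f^l being a divisor of the
characteristic polynomial (`total_cost_le`). -/

namespace JordanKrylov

/-! ### Value and cost of composed programs. -/

namespace Arith

variable {K α β : Type} [Field K] [DecidableEq K]

@[simp] lemma value_pure (a : α) : (pure a : Arith K α).value = a := rfl

@[simp] lemma cost_pure (a : α) : (pure a : Arith K α).cost = 0 := rfl

@[simp] lemma value_bind (x : Arith K α) (h : α → Arith K β) :
    (x >>= h).value = (h x.value).value := by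
  change (x.bind h).value = _
  induction x <;> simp [Arith.bind, value, *]

@[simp] lemma cost_bind (x : Arith K α) (h : α → Arith K β) :
    (x >>= h).cost = x.cost + (h x.value).cost := by
  change (x.bind h).cost = _
  induction x <;> simp [Arith.bind, value, cost, *] <;> omega

end Arith

open Arith

/-! ### Value and cost of the control structures and of vector arithmetic. -/

section Values

variable {K α β : Type} [Field K] [DecidableEq K] {n d : ℕ}

@[simp] lemma value_zero : (zero : Arith K K).value = 0 := rfl
@[simp] lemma cost_zero : (zero : Arith K K).cost = 0 := rfl
@[simp] lemma value_one : (one : Arith K K).value = 1 := rfl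
@[simp] lemma cost_one : (one : Arith K K).cost = 0 := rfl
@[simp] lemma value_add (x y : K) : (add x y).value = x + y := rfl
@[simp] lemma cost_add (x y : K) : (add x y).cost = 1 := rfl
@[simp] lemma value_sub (x y : K) : (sub x y).value = x - y := rfl
@[simp] lemma cost_sub (x y : K) : (sub x y).cost = 1 := rfl
@[simp] lemma value_mul (x y : K) : (mul x y).value = x * y := rfl
@[simp] lemma cost_mul (x y : K) : (mul x y).cost = 1 := rfl
@[simp] lemma value_div (x y : K) : (div x y).value = x / y := rfl
@[simp] lemma cost_div (x y : K) : (div x y).cost = 1 := rfl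
@[simp] lemma value_isZero (x : K) : (isZero x).value = decide (x = 0) := rfl
@[simp] lemma cost_isZero (x : K) : (isZero x).cost = 1 := rfl

@[simp] lemma value_tabulate (h : Fin n → Arith K α) :
    (tabulate n h).value = fun i => (h i).value := by
  induction n with
  | zero => funext i; exact i.elim0
  | succ n ih =>
    funext i
    simp only [tabulate, value_bind, value_pure, ih]
    refine Fin.cases ?_ (fun j => ?_) i <;> simp

@[simp] lemma cost_tabulate (h : Fin n → Arith K α) :
    (tabulate n h).cost = ∑ i, (h i).cost := by
  induction n with
  | zero => simp [tabulate]
  | succ n ih => simp [tabulate, ih, Fin.sum_univ_succ]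

@[simp] lemma value_forEach (h : α → Arith K β) (xs : List α) :
    (forEach h xs).value = xs.map (fun x => (h x).value) := by
  induction xs with
  | nil => rfl
  | cons x xs ih => simp [forEach, ih]

lemma cost_forEach (h : α → Arith K β) (xs : List α) :
    (forEach h xs).cost = (xs.map (fun x => (h x).cost)).sum := by
  induction xs with
  | nil => rfl
  | cons x xs ih => simp [forEach, ih]

lemma cost_forEach_le {h : α → Arith K β} {xs : List α} {c : ℕ}
    (hc : ∀ x ∈ xs, (h x).cost ≤ c) : (forEach h xs).cost ≤ xs.length * c := by
  rw [cost_forEach]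
  simpa using List.sum_le_card_nsmul (xs.map fun x => (h x).cost) c (by simpa using hc)

@[simp] lemma value_iterates (h : α → Arith K α) (j : ℕ) (x : α) :
    (iterates h j x).value = List.iterate (fun y => (h y).value) x j := by
  induction j generalizing x with
  | zero => rfl
  | succ j ih =>
    cases j with
    | zero => rfl
    | succ j => simp [iterates, ih]

/-- The cost of a step may depend on its argument, for instance on the length of an orbit; the
invariant `p` carries what keeps it below `c`. Only `j - 1` steps are made, so `j * c` is slightly
generous. -/
lemma cost_iterates_le {h : α → Arith K α} {p : α → Prop} {c : ℕ}
    (hc : ∀ x, p x → (h x).cost ≤ c ∧ p (h x).value) (j : ℕ) {x : α} (hx : p x) :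
    (iterates h j x).cost ≤ j * c := by
  induction j generalizing x with
  | zero => simp [iterates]
  | succ j ih =>
    cases j with
    | zero => simp [iterates]
    | succ j =>
      have h1 := (hc x hx).1
      have h2 := ih (hc x hx).2
      simp only [iterates, cost_bind, cost_pure, add_zero]
      rw [Nat.succ_mul (j + 1)]
      omega

@[simp] lemma value_dot (x y : Fin n → K) : (dot n x y).value = x ⬝ᵥ y := by
  induction n with
  | zero => simp [dot]
  | succ n ih => simp [dot, ih, dotProduct, Fin.sum_univ_succ]

@[simp] lemma cost_dot (x y : Fin n → K) : (dot n x y).cost = 2 * n := by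
  induction n with
  | zero => simp [dot]
  | succ n ih => simp [dot, ih]; ring

@[simp] lemma value_matVec (M : Matrix (Fin n) (Fin n) K) (v : Fin n → K) :
    (matVec M v).value = M.mulVec v := by
  simp [matVec]; rfl

@[simp] lemma cost_matVec (M : Matrix (Fin n) (Fin n) K) (v : Fin n → K) :
    (matVec M v).cost = 2 * n ^ 2 := by
  simp [matVec]; ring

@[simp] lemma cost_addVec (x y : Fin n → K) : (addVec x y).cost = n := by
  simp [addVec]

@[simp] lemma value_subSmul (c : K) (x y : Fin n → K) : (subSmul c x y).value = x - c • y := by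
  simp [subSmul]; rfl

@[simp] lemma cost_subSmul (c : K) (x y : Fin n → K) : (subSmul c x y).cost = 2 * n := by
  simp [subSmul]; ring

@[simp] lemma cost_zeroVec : (zeroVec (R := K) n).cost = 0 := by
  simp [zeroVec]

/-- That the index is the first one is not recorded: the echelon argument needs only a nonzero entry
at the pivot. -/
lemma value_firstNonzero (v : Fin n → K) :
    ((firstNonzero n v).value = none ∧ v = 0) ∨
      ∃ p, (firstNonzero n v).value = some p ∧ v p ≠ 0 := by
  induction n with
  | zero => exact Or.inl ⟨rfl, Subsingleton.elim _ _⟩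
  | succ n ih =>
    by_cases h0 : v 0 = 0
    · rcases ih (fun i => v i.succ) with ⟨h1, h2⟩ | ⟨p, h1, h2⟩
      · refine Or.inl ⟨by simp [firstNonzero, h0, h1], ?_⟩
        funext i
        refine Fin.cases h0 (fun j => congrFun h2 j) i
      · exact Or.inr ⟨p.succ, by simp [firstNonzero, h0, h1], h2⟩
    · exact Or.inr ⟨0, by simp [firstNonzero, h0], h0⟩

lemma cost_firstNonzero_le (v : Fin n → K) : (firstNonzero n v).cost ≤ n := by
  induction n with
  | zero => simp [firstNonzero]
  | succ n ih =>
    have := ih (fun i => v i.succ)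
    by_cases h0 : v 0 = 0
    · simp [firstNonzero, h0]; omega
    · simp [firstNonzero, h0]

end Values

/-! ### Trial division by a monic polynomial. -/

section Division

variable {K : Type} [Field K]

/-- The polynomial with a given list of coefficients, leading coefficient first. -/
noncomputable def toPoly : List K → K[X]
  | [] => 0
  | q :: rest => C q * X ^ rest.length + toPoly rest

lemma degree_toPoly_lt (p : List K) : (toPoly p).degree < p.length := by
  induction p with
  | nil => simp [toPoly]
  | cons q rest ih =>
    have h1 : (C q * X ^ rest.length : K[X]).degree < ((rest.length + 1 : ℕ) : WithBot ℕ) :=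
      (degree_C_mul_X_pow_le _ _).trans_lt (by exact_mod_cast Nat.lt_succ_self _)
    have h2 : (toPoly rest).degree < ((rest.length + 1 : ℕ) : WithBot ℕ) :=
      ih.trans (by exact_mod_cast Nat.lt_succ_self _)
    simpa [toPoly] using (degree_add_le _ _).trans_lt (max_lt h1 h2)

lemma toPoly_eq_zero_iff (p : List K) : toPoly p = 0 ↔ ∀ x ∈ p, x = 0 := by
  induction p with
  | nil => simp [toPoly]
  | cons q rest ih =>
    constructor
    · intro h
      have hq : q = 0 := by
        have h1 := congrArg (fun r => r.coeff rest.length) h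
        simpa [toPoly, coeff_eq_zero_of_degree_lt (degree_toPoly_lt rest)] using h1
      have h2 : toPoly rest = 0 := by simpa [toPoly, hq] using h
      simpa [hq] using ih.1 h2
    · intro h
      have hq : q = 0 := h q (by simp)
      have h2 : toPoly rest = 0 := ih.2 fun x hx => h x (by simp [hx])
      simp [toPoly, hq, h2]

lemma toPoly_reverse_range_map (c : ℕ → K) (m : ℕ) :
    toPoly ((List.range m).map c).reverse = ∑ i ∈ Finset.range m, C (c i) * X ^ i := by
  induction m with
  | zero => simp [toPoly]
  | succ m ih => simp [List.range_succ, toPoly, ih, Finset.sum_range_succ, add_comm]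

lemma toPoly_coeffList (p : K[X]) : toPoly (coeffList p) = p := by
  rw [coeffList, toPoly_reverse_range_map, ← as_sum_range_C_mul_X_pow]

lemma X_pow_add_toPoly {f : K[X]} (hf : f.Monic) :
    X ^ f.natDegree + toPoly (List.ofFn fun j : Fin f.natDegree => f.coeff j).reverse = f := by
  have h : (List.ofFn fun j : Fin f.natDegree => f.coeff j)
      = (List.range f.natDegree).map f.coeff := by
    rw [List.ofFn_eq_map, ← List.map_coe_finRange_eq_range, List.map_map]
    rfl
  rw [h, toPoly_reverse_range_map, ← hf.as_sum]

variable [DecidableEq K]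

lemma length_subPrefix (q : K) (cs xs : List K) :
    (subPrefix q cs xs).value.length = xs.length := by
  induction cs generalizing xs with
  | nil => simp [subPrefix]
  | cons c cs ih => cases xs <;> simp [subPrefix, ih]

/-- The two lists are aligned at their leading ends, so the shorter one is shifted by the `s`
coefficients that it does not reach. -/
lemma toPoly_subPrefix (q : K) (cs ys : List K) (s : ℕ) (h : ys.length = s + cs.length) :
    toPoly (subPrefix q cs ys).value = toPoly ys - C q * toPoly cs * X ^ s := by
  induction cs generalizing ys with
  | nil => simp [subPrefix, toPoly]
  | cons c cs ih =>
    cases ys with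
    | nil => simp at h
    | cons y ys =>
      have h' : ys.length = s + cs.length := by simp at h; omega
      simp only [subPrefix, value_bind, value_mul, value_sub, value_pure, toPoly,
        length_subPrefix, ih ys h', h', C_sub, C_mul, pow_add]
      ring

lemma cost_subPrefix_le (q : K) (cs xs : List K) :
    (subPrefix q cs xs).cost ≤ 2 * cs.length := by
  induction cs generalizing xs with
  | nil => simp [subPrefix]
  | cons c cs ih =>
    cases xs with
    | nil => simp [subPrefix]
    | cons x xs =>
      have := ih xs
      simp [subPrefix]
      omega

/-- Each step removes one leading coefficient, so the relation between the length of the dividend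
and the number of remaining steps is kept until exactly a remainder is left. -/
lemma divide_spec (lower : List K) (s : ℕ) (p : List K) (h : p.length = s + lower.length) :
    (divide lower s p).value.1.length = s ∧ (divide lower s p).value.2.length = lower.length ∧
      toPoly p = (X ^ lower.length + toPoly lower) * toPoly (divide lower s p).value.1 +
        toPoly (divide lower s p).value.2 := by
  induction s generalizing p with
  | zero => simpa [divide, toPoly] using h
  | succ s ih =>
    cases p with
    | nil => simp at h; omega
    | cons q rest =>
      have h' : rest.length = s + lower.length := by simp at h; omega
      obtain ⟨h1, h2, h3⟩ := ih (subPrefix q lower rest).value (by rw [length_subPrefix, h'])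
      rw [toPoly_subPrefix q lower rest s h'] at h3
      refine ⟨by simpa [divide] using h1, by simpa [divide] using h2, ?_⟩
      simp only [divide, value_bind, value_pure, toPoly, h1, h', pow_add]
      linear_combination h3

lemma cost_divide_le (lower : List K) (s : ℕ) (p : List K) :
    (divide lower s p).cost ≤ s * (2 * lower.length) := by
  induction s generalizing p with
  | zero => simp [divide]
  | succ s ih =>
    cases p with
    | nil => simp [divide]
    | cons q rest =>
      have h1 := cost_subPrefix_le q lower rest
      have h2 := ih (subPrefix q lower rest).value
      rw [Nat.succ_mul s]
      simp only [divide, cost_bind, cost_pure]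
      omega

lemma value_allZero (xs : List K) : (allZero xs).value = true ↔ ∀ x ∈ xs, x = 0 := by
  induction xs with
  | nil => simp [allZero]
  | cons x xs ih =>
    by_cases hx : x = 0
    · simp [allZero, hx, ih]
    · simp [allZero, hx]

lemma cost_allZero_le (xs : List K) : (allZero xs).cost ≤ xs.length := by
  induction xs with
  | nil => simp [allZero]
  | cons x xs ih =>
    by_cases hx : x = 0
    · simp [allZero, hx]; omega
    · simp [allZero, hx]

/-- Trial division splits off the exact power of the divisor, and its cost is bounded by the number
of divisions. -/
lemma splitOff_spec {f : K[X]} (hf : f.Monic) (lower : List K) (hlen : lower.length = f.natDegree)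
    (hd : 0 < f.natDegree) (hlower : X ^ lower.length + toPoly lower = f) (fuel : ℕ) (p : List K)
    (hfuel : p.length ≤ fuel) (hp : toPoly p ≠ 0) :
    toPoly p = f ^ (splitOff lower fuel p).value.1 * toPoly (splitOff lower fuel p).value.2 ∧
      ¬ f ∣ toPoly (splitOff lower fuel p).value.2 ∧
      (splitOff lower fuel p).cost ≤
        ((splitOff lower fuel p).value.1 + 1) * (2 * lower.length * p.length + lower.length) := by
  induction fuel generalizing p with
  | zero =>
    have : p = [] := List.length_eq_zero_iff.1 (by omega)
    simp [this, toPoly] at hp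
  | succ fuel ih =>
    by_cases hle : p.length ≤ lower.length
    · have hnd : ¬ f ∣ toPoly p := by
        refine hf.not_dvd_of_degree_lt hp ((degree_toPoly_lt p).trans_le ?_)
        rw [degree_eq_natDegree hf.ne_zero]
        exact_mod_cast hle.trans hlen.le
      simp [splitOff, hle, hnd]
    · have hs : p.length = (p.length - lower.length) + lower.length := by omega
      obtain ⟨h1, h2, h3⟩ := divide_spec lower _ p hs
      have hc1 := cost_divide_le lower (p.length - lower.length) p
      have hc2 := cost_allZero_le (divide lower (p.length - lower.length) p).value.2
      rw [hlower] at h3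
      rw [h2] at hc2
      set D := (divide lower (p.length - lower.length) p).value with hD
      have hc1' : (p.length - lower.length) * (2 * lower.length)
          ≤ 2 * lower.length * p.length := by
        rw [mul_comm]; exact Nat.mul_le_mul_left _ (Nat.sub_le _ _)
      by_cases hz : (allZero D.2).value = true
      · have hrem := (toPoly_eq_zero_iff D.2).2 ((value_allZero D.2).1 hz)
        rw [hrem, add_zero] at h3
        obtain ⟨i1, i2, i3⟩ := ih D.1 (by omega) (fun h0 => hp (by rw [h3, h0, mul_zero]))
        simp only [splitOff, hle, if_false, value_bind, cost_bind, ← hD, hz, if_true, value_pure,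
          cost_pure]
        refine ⟨by rw [h3, i1]; ring, i2, ?_⟩
        have hl : D.1.length ≤ p.length := by omega
        have : ((splitOff lower fuel D.1).value.1 + 1) *
            (2 * lower.length * D.1.length + lower.length) ≤
            ((splitOff lower fuel D.1).value.1 + 1) *
            (2 * lower.length * p.length + lower.length) := by gcongr
        rw [Nat.succ_mul]
        omega
      -- A nonzero remainder has degree below that of `f`, so it cannot be a multiple of `f`.
      · have hnd : ¬ f ∣ toPoly p := by
          intro hdvd
          have hr : f ∣ toPoly D.2 := by
            rw [h3] at hdvd
            exact (dvd_add_right (dvd_mul_right _ _)).1 hdvd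
          refine hz ((value_allZero D.2).2 ((toPoly_eq_zero_iff D.2).1 ?_))
          by_contra h0
          refine hf.not_dvd_of_degree_lt h0 ((degree_toPoly_lt _).trans_le ?_) hr
          rw [degree_eq_natDegree hf.ne_zero, h2, hlen]
        simp only [splitOff, hle, if_false, value_bind, cost_bind, ← hD, hz]
        refine ⟨by simp, by simpa using hnd, ?_⟩
        simp
        omega

end Division

/-! ### The Krylov generating set. -/

section Generators

/-- The step of `krylovGenerators` for the `i`-th basis vector. -/
def krylovGenerator {R : Type} {n d : ℕ} (inp : Input R n d) (i : Fin n) :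
    Arith R (Option (ℕ × (Fin n → R))) := do
  let (l, g) ← splitOff (List.ofFn inp.f).reverse (inp.P i).length (inp.P i)
  if l = 0 then pure none
  else if g.length ≤ 1 then pure (some (l, inp.E i))
  else
    let v ← matVec (inp.G i) (inp.E i)
    pure (some (l, v))

lemma krylovGenerators_eq {R : Type} {n d : ℕ} (inp : Input R n d) :
    krylovGenerators inp = (do
      let vs ← forEach (krylovGenerator inp) (List.finRange n)
      pure (vs.filterMap id)) := rfl

variable {K : Type} [Field K] {n : ℕ}

open Classical in
-- Trial division must be paid for every basis vector, but the product with a matrix only when `f`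
-- divides `p`; this is how r enters the count.
lemma krylovGenerator_spec [DecidableEq K] {A : Matrix (Fin n) (Fin n) K} {f p g : K[X]} {a l : ℕ}
    {inp : Input K n f.natDegree} {i : Fin n} (hf : f.Monic) (hirr : Irreducible f)
    (hinpf : inp.f = fun j : Fin f.natDegree => f.coeff j) (hP : inp.P i = coeffList p)
    (hG : inp.G i = aeval A g) (hp : p.Monic) (hpn : p.natDegree ≤ n)
    (hpg : p = f ^ a * g) (hg : ¬ f ∣ g) (hal : a ≤ l) :
    (krylovGenerator inp i).value =
        (if f ∣ p then some (a, (aeval A g).mulVec (inp.E i)) else none) ∧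
      (krylovGenerator inp i).cost ≤
        (l + 1) * (2 * f.natDegree * (n + 1) + f.natDegree) +
          (if f ∣ p then 2 * n ^ 2 else 0) := by
  set lower := (List.ofFn inp.f).reverse with hlow
  have hlen : lower.length = f.natDegree := by simp [hlow]
  have hlower : X ^ lower.length + toPoly lower = f := by
    rw [hlen, hlow, hinpf, X_pow_add_toPoly hf]
  have hPl : (inp.P i).length ≤ n + 1 := by simp [hP, coeffList, hpn]
  have hPt : toPoly (inp.P i) = p := by rw [hP, toPoly_coeffList]
  obtain ⟨h1, h2, h3⟩ := splitOff_spec hf lower hlen hirr.natDegree_pos hlower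
    (inp.P i).length (inp.P i) le_rfl (by rw [hPt]; exact hp.ne_zero)
  set s := (splitOff lower (inp.P i).length (inp.P i)).value with hs
  rw [hPt, hpg] at h1
  have hf0 := hf.ne_zero
  -- If the two exponents differed, cancelling the smaller power would leave `f` dividing one of the
  -- two cofactors.
  have hsa : s.1 = a := by
    rcases lt_trichotomy s.1 a with hlt | heq | hgt
    · refine absurd ?_ h2
      obtain ⟨t, rfl⟩ : ∃ t, a = s.1 + (t + 1) := ⟨a - s.1 - 1, by omega⟩
      rw [pow_add, mul_assoc] at h1
      rw [← mul_left_cancel₀ (pow_ne_zero _ hf0) h1, pow_succ']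
      exact ⟨f ^ t * g, by ring⟩
    · exact heq
    · refine absurd ?_ hg
      obtain ⟨t, ht⟩ : ∃ t, s.1 = a + (t + 1) := ⟨s.1 - a - 1, by omega⟩
      rw [ht, pow_add, mul_assoc] at h1
      rw [mul_left_cancel₀ (pow_ne_zero _ hf0) h1, pow_succ']
      exact ⟨f ^ t * toPoly s.2, by ring⟩
  rw [hsa] at h1
  have hsg : toPoly s.2 = g := (mul_left_cancel₀ (pow_ne_zero _ hf0) h1).symm
  have hdvd : f ∣ p ↔ a ≠ 0 := by
    constructor
    · rintro h rfl
      rw [hpg, pow_zero, one_mul] at h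
      exact hg h
    · intro h
      rw [hpg]
      exact (dvd_pow_self f h).mul_right g
  have hcost : (splitOff lower (inp.P i).length (inp.P i)).cost ≤
      (l + 1) * (2 * f.natDegree * (n + 1) + f.natDegree) := by
    rw [hsa, hlen] at h3
    exact h3.trans (by gcongr)
  -- A constant cofactor of a monic polynomial by a monic one equals 1, so skipping the product
  -- gives the same vector.
  have hval1 : s.2.length ≤ 1 → (aeval A g).mulVec (inp.E i) = inp.E i := by
    intro hl
    have hg1 : g = 1 := by
      have hgm : g.Monic := by
        rw [hpg] at hp
        exact (hf.pow a).of_mul_monic_left hp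
      have hdeg : g.degree < ((1 : ℕ) : WithBot ℕ) := by
        rw [← hsg]
        exact (degree_toPoly_lt s.2).trans_le (by exact_mod_cast hl)
      refine hgm.natDegree_eq_zero.1 ?_
      have := (natDegree_lt_iff_degree_lt hgm.ne_zero).2 hdeg
      omega
    simp [hg1]
  simp only [krylovGenerator, ← hlow, value_bind, cost_bind, ← hs, hsa]
  by_cases ha : a = 0
  · have hnd : ¬ f ∣ p := by simp [hdvd, ha]
    simp only [ha, if_true, hnd, if_false, value_pure, cost_pure]
    exact ⟨trivial, hcost⟩
  · have hd : f ∣ p := hdvd.2 ha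
    by_cases hl : s.2.length ≤ 1
    · simp only [ha, hl, hd, if_true, if_false, value_pure, cost_pure, hval1 hl]
      exact ⟨trivial, by omega⟩
    · simp only [ha, hl, hd, if_true, if_false, value_bind, cost_bind, value_pure, cost_pure,
        value_matVec, cost_matVec, hG]
      exact ⟨trivial, by omega⟩

/-- The polynomial f^(a-1) g is not a multiple of p = f^a g, because `f` is not a unit. -/
lemma rank_of_isMinimalAnnihilating {A : Matrix (Fin n) (Fin n) K} {f p g : K[X]} {a : ℕ}
    {e : Fin n → K} (hf : f.Monic) (hirr : Irreducible f) (hpg : p = f ^ a * g)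
    (hp : IsMinimalAnnihilating A e p) (ha : a ≠ 0) :
    (aeval A f ^ a).mulVec ((aeval A g).mulVec e) = 0 ∧
      (aeval A f ^ (a - 1)).mulVec ((aeval A g).mulVec e) ≠ 0 := by
  rw [Matrix.mulVec_mulVec, Matrix.mulVec_mulVec, ← map_pow, ← map_mul, ← map_pow, ← map_mul,
    ← hpg]
  refine ⟨(hp.2 p).2 dvd_rfl, fun h => ?_⟩
  have hdvd := (hp.2 _).1 h
  have hg0 : g ≠ 0 := by
    rintro rfl
    exact hp.1.ne_zero (by simpa using hpg)
  obtain ⟨b, rfl⟩ := Nat.exists_eq_succ_of_ne_zero ha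
  rw [hpg, pow_succ, mul_assoc, mul_comm f, ← mul_assoc, Nat.succ_sub_one] at hdvd
  have h0 : f ^ b * g ≠ 0 := mul_ne_zero (pow_ne_zero _ hf.ne_zero) hg0
  have : f ^ b * g * f ∣ f ^ b * g * 1 := by simpa using hdvd
  exact hirr.not_isUnit (isUnit_of_dvd_one ((mul_dvd_mul_iff_left h0).1 this))

/-- The Krylov generating set has at most `r` elements, their ranks are as stored, and it is
computed at the stated cost. -/
lemma krylovGenerators_spec [DecidableEq K] {A : Matrix (Fin n) (Fin n) K} {f : K[X]} {l : ℕ}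
    {P g : Fin n → K[X]} {a : Fin n → ℕ}
    {inp : Input K n f.natDegree} (hf : f.Monic) (hirr : Irreducible f)
    (hinpf : inp.f = fun j : Fin f.natDegree => f.coeff j) (hP : ∀ i, inp.P i = coeffList (P i))
    (hG : ∀ i, inp.G i = aeval A (g i)) (hmin : ∀ i, IsMinimalAnnihilating A (inp.E i) (P i))
    (hPn : ∀ i, (P i).natDegree ≤ n)
    (hPg : ∀ i, P i = f ^ a i * g i) (hg : ∀ i, ¬ f ∣ g i) (hal : ∀ i, a i ≤ l) :
    (krylovGenerators inp).value.length ≤ Set.ncard {i | f ∣ P i} ∧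
      (krylovGenerators inp).cost ≤
        n * ((l + 1) * (2 * f.natDegree * (n + 1) + f.natDegree)) +
          Set.ncard {i | f ∣ P i} * (2 * n ^ 2) ∧
      ∀ v ∈ (krylovGenerators inp).value, 1 ≤ v.1 ∧ v.1 ≤ l ∧
        (aeval A f ^ v.1).mulVec v.2 = 0 ∧ (aeval A f ^ (v.1 - 1)).mulVec v.2 ≠ 0 := by
  classical
  have hi := fun i => krylovGenerator_spec (l := l) hf hirr hinpf (hP i) (hG i) (hmin i).1 (hPn i)
    (hPg i) (hg i) (hal i)
  have hr : Set.ncard {i | f ∣ P i} = (Finset.univ.filter fun i => f ∣ P i).card := by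
    rw [Set.ncard_eq_toFinset_card']
    simp
  have hval : (krylovGenerators inp).value = (List.finRange n).filterMap fun i =>
      if f ∣ P i then some (a i, (aeval A (g i)).mulVec (inp.E i)) else none := by
    rw [krylovGenerators_eq]
    simp only [value_bind, value_forEach, value_pure, List.filterMap_map]
    congr 1
    funext i
    exact (hi i).1
  have hcount : (List.finRange n).countP (fun i => decide (f ∣ P i)) =
      Set.ncard {i | f ∣ P i} := by
    rw [hr, List.countP_eq_length_filter, ← List.toFinset_card_of_nodup
      ((List.nodup_finRange n).filter _)]
    congr 1
    ext i
    simp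
  refine ⟨?_, ?_, ?_⟩
  · rw [hval, ← hcount, List.length_filterMap_eq_countP]
    refine (List.countP_congr fun i _ => ?_).le
    by_cases h : f ∣ P i <;> simp [h]
  · rw [krylovGenerators_eq]
    simp only [cost_bind, cost_pure, add_zero, cost_forEach]
    rw [← List.ofFn_eq_map, List.sum_ofFn]
    refine (Finset.sum_le_sum fun i _ => (hi i).2).trans (le_of_eq ?_)
    rw [Finset.sum_add_distrib, Finset.sum_ite, hr]
    simp
  · intro v hv
    rw [hval, List.mem_filterMap] at hv
    obtain ⟨i, -, hv⟩ := hv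
    by_cases h : f ∣ P i
    · rw [if_pos h, Option.some.injEq] at hv
      subst hv
      have ha : a i ≠ 0 := by
        intro h0
        have := hPg i
        rw [h0, pow_zero, one_mul] at this
        exact hg i (this ▸ h)
      exact ⟨Nat.one_le_iff_ne_zero.2 ha, hal i,
        rank_of_isMinimalAnnihilating hf hirr (hPg i) (hmin i) ha⟩
    · simp [h] at hv

end Generators

/-! ### Orbits under N = f(A), and echelon form. -/

section Orbits

variable {K : Type} [Field K] {n : ℕ}

/-- The list `o` has the form `[N^(j-1) v, …, N v, v]` with `N^j v = 0`. -/
def IsOrbit (N : Matrix (Fin n) (Fin n) K) (o : Orbit K n) : Prop :=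
  List.IsChain (fun x y => N.mulVec y = x) (0 :: o)

/-- The first entry of an orbit. -/
def top (o : Orbit K n) : Fin n → K := o.headD 0

lemma isChain_zipWith_sub {N : Matrix (Fin n) (Fin n) K} (q : K) (u c : Orbit K n)
    (hu : List.IsChain (fun x y => N.mulVec y = x) u)
    (hc : List.IsChain (fun x y => N.mulVec y = x) c) :
    List.IsChain (fun x y => N.mulVec y = x) (List.zipWith (fun x y => x - q • y) u c) := by
  induction u generalizing c with
  | nil => simp
  | cons x xs ih =>
    cases c with
    | nil => simp
    | cons y ys =>
      cases xs with
      | nil => simp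
      | cons x' xs =>
        cases ys with
        | nil => simp
        | cons y' ys =>
          rw [List.isChain_cons_cons] at hu hc
          have h := ih (y' :: ys) hu.2 hc.2
          simp only [List.zipWith_cons_cons, List.isChain_cons_cons] at h ⊢
          exact ⟨by rw [Matrix.mulVec_sub, Matrix.mulVec_smul, hu.1, hc.1], h⟩

lemma IsOrbit.zipWith_sub {N : Matrix (Fin n) (Fin n) K} {u c : Orbit K n} (hu : IsOrbit N u)
    (hc : IsOrbit N c) (q : K) : IsOrbit N (List.zipWith (fun x y => x - q • y) u c) := by
  have := isChain_zipWith_sub q _ _ hu hc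
  simpa [IsOrbit] using this

/-- This is the step from S to f(A) S: without its last entry v the orbit is that of N v. -/
lemma IsOrbit.dropLast {N : Matrix (Fin n) (Fin n) K} {o : Orbit K n} (ho : IsOrbit N o) :
    IsOrbit N o.dropLast :=
  List.IsChain.prefix ho (List.cons_prefix_cons.2 ⟨rfl, o.dropLast_prefix⟩)

lemma IsOrbit.map {N A : Matrix (Fin n) (Fin n) K} {o : Orbit K n} (ho : IsOrbit N o)
    (hA : Commute N A) : IsOrbit N (o.map A.mulVec) := by
  have h : List.IsChain (fun x y => N.mulVec y = x) ((0 :: o).map A.mulVec) := by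
    rw [List.isChain_map]
    refine List.IsChain.imp (fun x y hxy => ?_) ho
    rw [Matrix.mulVec_mulVec, hA.eq, ← Matrix.mulVec_mulVec, hxy]
  simpa [IsOrbit] using h

lemma isOrbit_iterate (N : Matrix (Fin n) (Fin n) K) (l : ℕ) (v : Fin n → K)
    (hv : (N ^ l).mulVec v = 0) : IsOrbit N (List.iterate N.mulVec v l).reverse := by
  have h : List.IsChain (fun x y => N.mulVec x = y) (List.iterate N.mulVec v l ++ [0]) := by
    induction l generalizing v with
    | zero => simp
    | succ l ih =>
      have h' := ih (N.mulVec v) (by rwa [Matrix.mulVec_mulVec, ← pow_succ])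
      cases l with
      | zero => simpa using hv
      | succ l =>
        simp only [List.iterate, List.cons_append, List.isChain_cons_cons] at h' ⊢
        exact ⟨trivial, h'⟩
  have h2 : List.IsChain (fun x y => N.mulVec y = x)
      (List.iterate N.mulVec v l ++ [0]).reverse := List.isChain_reverse.2 h
  simpa [IsOrbit] using h2

lemma top_iterate (N : Matrix (Fin n) (Fin n) K) (l : ℕ) (v : Fin n → K) :
    top (List.iterate N.mulVec v (l + 1)).reverse = (N ^ l).mulVec v := by
  induction l generalizing v with
  | zero => simp [top]
  | succ l ih =>
    rw [pow_succ, ← Matrix.mulVec_mulVec, ← ih]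
    simp [top, List.headD_eq_head?_getD, List.head?_append]

lemma IsOrbit.top_mem_ker {N : Matrix (Fin n) (Fin n) K} {o : Orbit K n} (ho : IsOrbit N o) :
    top o ∈ LinearMap.ker N.mulVecLin := by
  cases o with
  | nil => simp [top]
  | cons x xs =>
    rw [IsOrbit, List.isChain_cons_cons] at ho
    simpa [top] using ho.1

lemma IsOrbit.top_mem_range {N : Matrix (Fin n) (Fin n) K} {o : Orbit K n} (ho : IsOrbit N o)
    (hl : 2 ≤ o.length) : top o ∈ LinearMap.range N.mulVecLin := by
  match o, ho, hl with
  | x :: y :: xs, ho, _ =>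
    rw [IsOrbit, List.isChain_cons_cons, List.isChain_cons_cons] at ho
    exact ⟨y, by simpa [top] using ho.2.1⟩

/-- The vectors of `ker N` that are images under `N`. -/
def kerRange (N : Matrix (Fin n) (Fin n) K) : Submodule K (Fin n → K) :=
  LinearMap.ker N.mulVecLin ⊓ LinearMap.range N.mulVecLin

/-- The property that makes vectors of rank at least two redundant once W spans ker N ∩ im N. -/
lemma IsOrbit.top_mem_kerRange {N : Matrix (Fin n) (Fin n) K} {o : Orbit K n} (ho : IsOrbit N o)
    (hl : 2 ≤ o.length) : top o ∈ kerRange N :=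
  ⟨ho.top_mem_ker, ho.top_mem_range hl⟩

/-! ### Reduced columns -/

/-- The submodule spanned by the columns of `W`. -/
def colSpan (cols : List (Column K n)) : Submodule K (Fin n → K) :=
  Submodule.span K {x | ∃ c ∈ cols, top c.orbit = x}

lemma top_mem_colSpan {cols : List (Column K n)} {c : Column K n} (hc : c ∈ cols) :
    top c.orbit ∈ colSpan cols :=
  Submodule.subset_span ⟨c, hc, rfl⟩

lemma colSpan_mono {cols cols' : List (Column K n)} (h : ∀ c ∈ cols, c ∈ cols') :
    colSpan cols ≤ colSpan cols' :=
  Submodule.span_mono (by rintro x ⟨c, hc, rfl⟩; exact ⟨c, h c hc, rfl⟩)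

/-- The columns are in echelon form, and all orbits have length `l`. -/
structure Reduced (l : ℕ) (cols : List (Column K n)) : Prop where
  length_eq : ∀ c ∈ cols, c.orbit.length = l
  pivot_ne : ∀ c ∈ cols, top c.orbit c.pivot ≠ 0
  pairwise : cols.Pairwise fun c c' => top c'.orbit c.pivot = 0

lemma Reduced.of_cons {l : ℕ} {c : Column K n} {cs : List (Column K n)}
    (h : Reduced l (c :: cs)) : Reduced l cs :=
  ⟨fun c' hc' => h.length_eq c' (by simp [hc']), fun c' hc' => h.pivot_ne c' (by simp [hc']),
    (List.pairwise_cons.1 h.pairwise).2⟩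

lemma Reduced.nil (l : ℕ) : Reduced l ([] : List (Column K n)) :=
  ⟨by simp, by simp, List.Pairwise.nil⟩

/-- A column vanishes at all earlier pivots but not at its own, so the pivots are distinct indices.
-/
lemma Reduced.length_le {l : ℕ} {cols : List (Column K n)} (h : Reduced l cols) :
    cols.length ≤ n := by
  have hnd : (cols.map Column.pivot).Nodup := by
    rw [List.Nodup, List.pairwise_map]
    refine List.Pairwise.imp_of_mem (fun {a b} _ hb hab heq => ?_) h.pairwise
    exact h.pivot_ne b hb (heq ▸ hab)
  simpa using hnd.length_le_card

/-- A linear combination of the columns of `W` that vanishes at all pivots is zero. -/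
lemma Reduced.eq_zero {l : ℕ} {cols : List (Column K n)} (h : Reduced l cols) {x : Fin n → K}
    (hx : x ∈ colSpan cols) (hp : ∀ c ∈ cols, x c.pivot = 0) : x = 0 := by
  induction cols generalizing x with
  | nil => simpa [colSpan] using hx
  | cons c cs ih =>
    have hset : {x | ∃ c' ∈ c :: cs, top c'.orbit = x} =
        insert (top c.orbit) {x | ∃ c' ∈ cs, top c'.orbit = x} := by
      ext y
      simp [eq_comm]
    rw [colSpan, hset, Submodule.mem_span_insert] at hx
    obtain ⟨a, y, hy, rfl⟩ := hx
    -- All later columns vanish at the first pivot, so the entry there determines the coefficient of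
    -- the first column.
    have hyp : y c.pivot = 0 := by
      have hle : colSpan cs ≤ LinearMap.ker (LinearMap.proj (R := K) (φ := fun _ => K) c.pivot) := by
        refine Submodule.span_le.2 ?_
        rintro _ ⟨c', hc', rfl⟩
        exact (List.pairwise_cons.1 h.pairwise).1 c' hc'
      exact hle hy
    have ha : a = 0 := by
      have := hp c (by simp)
      simpa [hyp, h.pivot_ne c (by simp)] using this
    subst ha
    rw [zero_smul, zero_add] at hp ⊢
    exact ih h.of_cons hy fun c' hc' => hp c' (by simp [hc'])

lemma Reduced.append {l : ℕ} {cols : List (Column K n)} (h : Reduced l cols) {u : Orbit K n}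
    {p : Fin n} (hu : u.length = l) (hp : top u p ≠ 0)
    (hv : ∀ c ∈ cols, top u c.pivot = 0) : Reduced l (cols ++ [⟨p, u⟩]) := by
  refine ⟨?_, ?_, ?_⟩
  · intro c hc
    rcases List.mem_append.1 hc with hc | hc
    · exact h.length_eq c hc
    · rw [List.mem_singleton.1 hc]; exact hu
  · intro c hc
    rcases List.mem_append.1 hc with hc | hc
    · exact h.pivot_ne c hc
    · rw [List.mem_singleton.1 hc]; exact hp
  · rw [List.pairwise_append]
    refine ⟨h.pairwise, List.pairwise_singleton _ _, fun a ha b hb => ?_⟩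
    rw [List.mem_singleton.1 hb]
    exact hv a ha

lemma top_dropLast (o : Orbit K n) (h : 2 ≤ o.length) : top o.dropLast = top o := by
  match o, h with
  | x :: y :: xs, _ => simp [top]

/-- Replacing S by f(A) S leaves W alone as long as every orbit keeps its head, which is why `1 ≤ l`
is needed. Pivots and span thus survive the change of rank. -/
lemma Reduced.map_dropLast {l : ℕ} {cols : List (Column K n)} (h : Reduced (l + 1) cols)
    (hl : 1 ≤ l) :
    Reduced l (cols.map fun c => { c with orbit := c.orbit.dropLast }) ∧
      colSpan (cols.map fun c => { c with orbit := c.orbit.dropLast }) = colSpan cols := by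
  have ht : ∀ c ∈ cols, top c.orbit.dropLast = top c.orbit := fun c hc =>
    top_dropLast _ (by rw [h.length_eq c hc]; omega)
  refine ⟨⟨?_, ?_, ?_⟩, ?_⟩
  · simp only [List.mem_map, forall_exists_index, and_imp, forall_apply_eq_imp_iff₂]
    intro c hc
    simp [h.length_eq c hc]
  · simp only [List.mem_map, forall_exists_index, and_imp, forall_apply_eq_imp_iff₂]
    intro c hc
    rw [ht c hc]
    exact h.pivot_ne c hc
  · rw [List.pairwise_map]
    refine List.Pairwise.imp_of_mem (fun {a b} _ hb hab => ?_) h.pairwise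
    rw [ht b hb]
    exact hab
  · unfold colSpan
    congr 1
    ext x
    constructor
    · rintro ⟨c', hc', rfl⟩
      obtain ⟨c, hc, rfl⟩ := List.mem_map.1 hc'
      exact ⟨c, hc, (ht c hc).symm⟩
    · rintro ⟨c, hc, rfl⟩
      exact ⟨_, List.mem_map.2 ⟨c, hc, rfl⟩, ht c hc⟩

end Orbits

/-! ### Simultaneous column reduction and its cost. -/

section Elimination

variable {K : Type} [Field K] [DecidableEq K] {n : ℕ}

lemma value_orbit (N : Matrix (Fin n) (Fin n) K) (l : ℕ) (v : Fin n → K) :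
    (orbit N l v).value = (List.iterate N.mulVec v l).reverse := by
  simp [orbit]

lemma cost_orbit_le (N : Matrix (Fin n) (Fin n) K) (l : ℕ) (v : Fin n → K) :
    (orbit N l v).cost ≤ l * (2 * n ^ 2) := by
  have := cost_iterates_le (h := matVec N) (p := fun _ => True) (c := 2 * n ^ 2)
    (fun x _ => ⟨by simp, trivial⟩) l (x := v) trivial
  simpa [orbit] using this

lemma value_subOrbit (q : K) (u c : Orbit K n) :
    (subOrbit q u c).value = List.zipWith (fun x y => x - q • y) u c := by
  induction u generalizing c with
  | nil => rfl
  | cons x xs ih => cases c <;> simp [subOrbit, ih]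

lemma cost_subOrbit_le (q : K) (u c : Orbit K n) :
    (subOrbit q u c).cost ≤ u.length * (2 * n) := by
  induction u generalizing c with
  | nil => simp [subOrbit]
  | cons x xs ih =>
    cases c with
    | nil => simp [subOrbit]
    | cons y ys =>
      have := ih ys
      simp only [subOrbit, cost_bind, cost_subSmul, cost_pure, List.length_cons,
        Nat.succ_mul xs.length]
      omega

/-- The third clause serves the induction: later columns vanish at the pivot just cleared, so that
entry stays zero. -/
lemma reduceBy_spec {l : ℕ} (hl : 1 ≤ l) {cols : List (Column K n)} (h : Reduced l cols)
    {u : Orbit K n} (hu : u.length = l) :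
    (reduceBy cols u).value.length = l ∧
      (∀ c ∈ cols, top (reduceBy cols u).value c.pivot = 0) ∧
      (∀ p, (∀ c ∈ cols, top c.orbit p = 0) → top (reduceBy cols u).value p = top u p) ∧
      top u - top (reduceBy cols u).value ∈ colSpan cols ∧
      (∀ N : Matrix (Fin n) (Fin n) K, IsOrbit N u → (∀ c ∈ cols, IsOrbit N c.orbit) →
        IsOrbit N (reduceBy cols u).value) ∧
      (reduceBy cols u).cost ≤ cols.length * (1 + l * (2 * n)) := by
  induction cols generalizing u with
  | nil =>
    cases u with
    | nil => simp at hu; omega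
    | cons x xs => simp [reduceBy, hu]
  | cons c cs ih =>
    have hcl := h.length_eq c (by simp)
    have hcp := h.pivot_ne c (by simp)
    obtain ⟨p, o⟩ := c
    cases u with
    | nil => simp at hu; omega
    | cons x xs =>
      cases o with
      | nil => simp at hcl; omega
      | cons w ws =>
        have hlen : (List.zipWith (fun a b => a - (x p / w p) • b) (x :: xs) (w :: ws)).length = l :=
          by rw [List.length_zipWith, hu, hcl, min_self]
        obtain ⟨i1, i2, i3, i4, i5, i6⟩ := ih h.of_cons hlen
        have hval : (reduceBy (⟨p, w :: ws⟩ :: cs) (x :: xs)).value =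
            (reduceBy cs (List.zipWith (fun a b => a - (x p / w p) • b) (x :: xs) (w :: ws))).value :=
          by simp [reduceBy, value_subOrbit]
        have htop : top (List.zipWith (fun a b => a - (x p / w p) • b) (x :: xs) (w :: ws)) =
            x - (x p / w p) • w := by simp [top]
        rw [htop] at i3 i4
        have hwp : w p ≠ 0 := by simpa [top] using hcp
        rw [hval]
        refine ⟨i1, ?_, ?_, ?_, ?_, ?_⟩
        · intro c' hc'
          rcases List.mem_cons.1 hc' with rfl | hc'
          · rw [i3 p fun c' hc' => (List.pairwise_cons.1 h.pairwise).1 c' hc']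
            simp [hwp]
          · exact i2 c' hc'
        · intro p' hp'
          rw [i3 p' fun c' hc' => hp' c' (by simp [hc'])]
          have : w p' = 0 := by simpa [top] using hp' ⟨p, w :: ws⟩ (by simp)
          simp [top, this]
        · have h1 : w ∈ colSpan (⟨p, w :: ws⟩ :: cs) :=
            top_mem_colSpan (c := ⟨p, w :: ws⟩) (by simp)
          have h2 := colSpan_mono (cols' := ⟨p, w :: ws⟩ :: cs) (fun c hc => by simp [hc]) i4
          have h3 := Submodule.add_mem _ (Submodule.smul_mem _ (x p / w p) h1) h2
          have e : top (x :: xs) = x := rfl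
          rw [e]
          convert h3 using 1
          abel
        · intro N hN hcN
          exact i5 N (hN.zipWith_sub (hcN ⟨p, w :: ws⟩ (by simp)) _)
            fun c' hc' => hcN c' (by simp [hc'])
        · have hsub := cost_subOrbit_le (x p / w p) (x :: xs) (w :: ws)
          rw [hu] at hsub
          simp only [reduceBy, cost_bind, cost_div, value_div, value_subOrbit, List.length_cons]
          simp only [List.zipWith_cons_cons] at i6 ⊢
          rw [Nat.succ_mul]
          omega

lemma addColumn_spec {l : ℕ} (hl : 1 ≤ l) {cols : List (Column K n)} (h : Reduced l cols)
    {u : Orbit K n} (hu : u.length = l) :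
    Reduced l (addColumn cols u).value ∧
      (∀ N : Matrix (Fin n) (Fin n) K, IsOrbit N u → (∀ c ∈ cols, IsOrbit N c.orbit) →
        ∀ c ∈ (addColumn cols u).value, IsOrbit N c.orbit) ∧
      colSpan cols ≤ colSpan (addColumn cols u).value ∧
      top u ∈ colSpan (addColumn cols u).value ∧
      (addColumn cols u).value.length ≤ cols.length + 1 ∧
      (addColumn cols u).cost ≤ cols.length * (1 + l * (2 * n)) + n := by
  obtain ⟨i1, i2, -, i4, i5, i6⟩ := reduceBy_spec hl h hu
  rcases hr : (reduceBy cols u).value with _ | ⟨w, ws⟩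
  · rw [hr] at i1
    simp at i1
    omega
  · rw [hr] at i1 i2 i4 i5
    have hw : top (w :: ws) = w := rfl
    rw [hw] at i2 i4
    have hc := cost_firstNonzero_le w
    rcases value_firstNonzero w with ⟨h1, h2⟩ | ⟨p, h1, h2⟩
    · have hval : (addColumn cols u).value = cols := by simp [addColumn, hr, h1]
      rw [hval]
      refine ⟨h, fun N _ hN => hN, le_rfl, by simpa [h2] using i4, by omega, ?_⟩
      simp only [addColumn, cost_bind, hr, h1, cost_pure]
      omega
    · have hval : (addColumn cols u).value = cols ++ [⟨p, w :: ws⟩] := by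
        simp [addColumn, hr, h1]
      rw [hval]
      have hle : colSpan cols ≤ colSpan (cols ++ [⟨p, w :: ws⟩]) :=
        colSpan_mono fun c hc => by simp [hc]
      refine ⟨h.append i1 h2 i2, ?_, hle, ?_, by simp, ?_⟩
      · intro N hN hcN c hc
        rcases List.mem_append.1 hc with hc | hc
        · exact hcN c hc
        · rw [List.mem_singleton.1 hc]
          exact i5 N hN hcN
      · have h1 : w ∈ colSpan (cols ++ [⟨p, w :: ws⟩]) :=
          top_mem_colSpan (c := ⟨p, w :: ws⟩) (by simp)
        simpa using Submodule.add_mem _ (hle i4) h1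
      · simp only [addColumn, cost_bind, hr, h1, cost_pure]
        omega

lemma addColumns_spec {l : ℕ} (hl : 1 ≤ l) {cols : List (Column K n)} (h : Reduced l cols)
    {us : List (Orbit K n)} (hu : ∀ u ∈ us, u.length = l) :
    Reduced l (addColumns cols us).value ∧
      (∀ N : Matrix (Fin n) (Fin n) K, (∀ u ∈ us, IsOrbit N u) → (∀ c ∈ cols, IsOrbit N c.orbit) →
        ∀ c ∈ (addColumns cols us).value, IsOrbit N c.orbit) ∧
      colSpan cols ≤ colSpan (addColumns cols us).value ∧
      (∀ u ∈ us, top u ∈ colSpan (addColumns cols us).value) ∧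
      (addColumns cols us).value.length ≤ cols.length + us.length ∧
      (addColumns cols us).cost ≤ us.length * (n * (1 + l * (2 * n)) + n) := by
  induction us generalizing cols with
  | nil => simp [addColumns, h]
  | cons u us ih =>
    obtain ⟨a1, a2, a3, a4, a5, a6⟩ := addColumn_spec hl h (hu u (by simp))
    obtain ⟨i1, i2, i3, i4, i5, i6⟩ := ih a1 fun u' hu' => hu u' (by simp [hu'])
    simp only [addColumns, value_bind, cost_bind, List.length_cons]
    refine ⟨i1, ?_, a3.trans i3, ?_, by omega, ?_⟩
    · intro N hN hcN
      exact i2 N (fun u' hu' => hN u' (by simp [hu'])) (a2 N (hN u (by simp)) hcN)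
    · intro u' hu'
      rcases List.mem_cons.1 hu' with rfl | hu'
      · exact i3 a4
      · exact i4 u' hu'
    · have : cols.length * (1 + l * (2 * n)) ≤ n * (1 + l * (2 * n)) :=
        Nat.mul_le_mul_right _ h.length_le
      rw [Nat.succ_mul]
      omega

/-- The cost of appending the columns `r, A r, …, A^(d-1) r`. -/
def krylovCost (n d l : ℕ) : ℕ := d * (l * (2 * n ^ 2)) + d * (n * (1 + l * (2 * n)) + n)

/-- As A commutes with N, it maps orbits to orbits, so the whole block can be appended orbit by
orbit; echelon form caps the number of columns in each reduction by n. -/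
lemma addKrylov_spec {l d : ℕ} (hl : 1 ≤ l) {A : Matrix (Fin n) (Fin n) K}
    {cols : List (Column K n)} (h : Reduced l cols) {u : Orbit K n} (hu : u.length = l) :
    Reduced l (addKrylov A d cols u).value ∧
      (∀ N : Matrix (Fin n) (Fin n) K, Commute N A → IsOrbit N u →
        (∀ c ∈ cols, IsOrbit N c.orbit) →
        ∀ c ∈ (addKrylov A d cols u).value, IsOrbit N c.orbit) ∧
      (∀ j < d, (A ^ j).mulVec (top u) ∈ colSpan (addKrylov A d cols u).value) ∧
      (addKrylov A d cols u).value.length ≤ cols.length + d ∧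
      (addKrylov A d cols u).cost ≤ krylovCost n d l := by
  have hmem : ∀ (m : ℕ) (v : Orbit K n), ∀ w ∈ List.iterate (List.map A.mulVec) v m,
      w.length = v.length ∧ ∀ N : Matrix (Fin n) (Fin n) K, Commute N A → IsOrbit N v →
        IsOrbit N w := by
    intro m
    induction m with
    | zero => simp
    | succ m ih =>
      intro v w hw
      simp only [List.iterate, List.mem_cons] at hw
      rcases hw with rfl | hw
      · exact ⟨rfl, fun N _ h => h⟩
      · obtain ⟨h1, h2⟩ := ih _ _ hw
        exact ⟨by simpa using h1, fun N hN hv => h2 N hN (hv.map hN)⟩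
  have htop : ∀ (m : ℕ) (v : Orbit K n), v.length = l → ∀ j < m,
      ∃ w ∈ List.iterate (List.map A.mulVec) v m, top w = (A ^ j).mulVec (top v) := by
    intro m
    induction m with
    | zero => simp
    | succ m ih =>
      intro v hv j hj
      cases j with
      | zero => exact ⟨v, by simp, by simp⟩
      | succ j =>
        obtain ⟨w, hw, hw'⟩ := ih (v.map A.mulVec) (by simpa using hv) j (by omega)
        refine ⟨w, by simp [hw], ?_⟩
        rw [hw', pow_succ, ← Matrix.mulVec_mulVec]
        congr 1
        cases v with
        | nil => simp at hv; omega
        | cons x xs => simp [top]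
  have hval : (iterates (forEach (matVec A)) d u).value = List.iterate (List.map A.mulVec) u d := by
    simp only [value_iterates, value_forEach, value_matVec]
  have hcost : (iterates (forEach (matVec A)) d u).cost ≤ d * (l * (2 * n ^ 2)) :=
    cost_iterates_le (p := fun v => v.length = l) (fun v hv =>
      ⟨hv ▸ cost_forEach_le (h := matVec A) (xs := v) (c := 2 * n ^ 2)
        (fun x _ => (cost_matVec A x).le), by simpa using hv⟩) d hu
  obtain ⟨i1, i2, -, i4, i5, i6⟩ := addColumns_spec hl h
    (us := List.iterate (List.map A.mulVec) u d) fun w hw => by rw [(hmem d u w hw).1, hu]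
  rw [List.length_iterate] at i5 i6
  simp only [addKrylov, value_bind, cost_bind, hval, krylovCost]
  refine ⟨i1, ?_, ?_, i5, by omega⟩
  · intro N hNA hN hcN
    exact i2 N (fun w hw => (hmem d u w hw).2 N hNA hN) hcN
  · intro j hj
    obtain ⟨w, hw, hw'⟩ := htop d u hu j hj
    rw [← hw']
    exact i4 w hw

lemma trim_spec (u : Orbit K n) :
    (trim u).value.length ≤ u.length ∧
      ((trim u).value.length = u.length → (trim u).value = u ∧ (1 ≤ u.length → top u ≠ 0)) ∧
      (∀ N : Matrix (Fin n) (Fin n) K, IsOrbit N u → IsOrbit N (trim u).value) ∧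
      (trim u).cost ≤ u.length * n := by
  induction u with
  | nil => simp [trim]
  | cons x xs ih =>
    obtain ⟨i1, -, i3, i4⟩ := ih
    have hc := cost_firstNonzero_le x
    rcases value_firstNonzero x with ⟨h1, h2⟩ | ⟨p, h1, h2⟩
    · have hval : (trim (x :: xs)).value = (trim xs).value := by simp [trim, h1]
      rw [hval]
      refine ⟨by simp; omega, fun h => by simp at h; omega, fun N hN => i3 N ?_, ?_⟩
      -- A zero head takes over the role of the 0 placed in front of an orbit, so the tail is again
      -- an orbit.
      · rw [IsOrbit, List.isChain_cons_cons, h2] at hN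
        exact hN.2
      · simp only [trim, cost_bind, h1, List.length_cons, Nat.succ_mul]
        omega
    · have hval : (trim (x :: xs)).value = x :: xs := by simp [trim, h1]
      rw [hval]
      refine ⟨le_rfl, fun _ => ⟨rfl, fun _ h => h2 ?_⟩, fun N hN => hN, ?_⟩
      · have : x = 0 := h
        simp [this]
      · simp only [trim, cost_bind, h1, List.length_cons, Nat.succ_mul, cost_pure]
        omega

end Elimination

/-! ### The loops of the Jordan–Krylov elimination. -/

section Loops

variable {K : Type} [Field K] [DecidableEq K] {n d : ℕ}

/-- For ranks above one, once `W` spans `ker N ∩ im N`, the while-loop adds no vector to `B`. -/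
lemma whileLoop_of_two_le {A N : Matrix (Fin n) (Fin n) K} {l : ℕ} (hl : 2 ≤ l)
    (vs : List (Orbit K n)) (st : State K n) (h : Reduced l st.cols)
    (hcN : ∀ c ∈ st.cols, IsOrbit N c.orbit) (hspan : kerRange N ≤ colSpan st.cols)
    (hvs : ∀ v ∈ vs, IsOrbit N v ∧ v.length = l) :
    (whileLoop A d l vs st).value.B = st.B ∧
      (whileLoop A d l vs st).value.cols = st.cols ∧
      (∃ ts, (whileLoop A d l vs st).value.V = st.V ++ ts ∧ ts.length ≤ vs.length ∧
        ∀ t ∈ ts, IsOrbit N t ∧ 1 ≤ t.length ∧ t.length < l) ∧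
      (whileLoop A d l vs st).cost ≤
        vs.length * (st.cols.length * (1 + l * (2 * n)) + l * n) := by
  induction vs generalizing st with
  | nil => simp [whileLoop]
  | cons v vs ih =>
    obtain ⟨hv, hvl⟩ := hvs v (by simp)
    obtain ⟨r1, r2, -, -, r5, r6⟩ := reduceBy_spec (by omega) h hvl
    set u := (reduceBy st.cols v).value with hu
    obtain ⟨t1, t2, t3, t4⟩ := trim_spec u
    set t := (trim u).value with ht
    have huN := r5 N hv hcN
    -- Otherwise the reduced head would be nonzero, although it lies in ker N ∩ im N, hence in the
    -- span of W, and vanishes at every pivot.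
    have hne : t.length ≠ l := by
      intro h0
      refine (t2 (by omega)).2 (by omega) (h.eq_zero (hspan ?_) r2)
      exact huN.top_mem_kerRange (by omega)
    rw [r1] at t4
    have hvs' : ∀ v ∈ vs, IsOrbit N v ∧ v.length = l := fun v hv => hvs v (by simp [hv])
    simp only [whileLoop, value_bind, cost_bind, ← hu, ← ht, if_neg hne, List.length_cons,
      Nat.succ_mul vs.length]
    by_cases h0 : t.length = 0
    · obtain ⟨i1, i2, ⟨ts, i3, i4, i5⟩, i6⟩ := ih st h hcN hspan hvs'
      simp only [if_pos h0]
      exact ⟨i1, i2, ⟨ts, i3, by omega, i5⟩, by omega⟩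
    · obtain ⟨i1, i2, ⟨ts, i3, i4, i5⟩, i6⟩ :=
        ih { st with V := st.V ++ [t] } h hcN hspan hvs'
      simp only [if_neg h0]
      refine ⟨i1, i2, ⟨t :: ts, ?_, ?_, ?_⟩, ?_⟩
      · rw [i3, List.append_assoc, List.singleton_append]
      · simp only [List.length_cons]; omega
      · intro t' ht'
        rcases List.mem_cons.1 ht' with rfl | ht'
        · exact ⟨t3 N huN, by omega, by omega⟩
        · exact i5 t' ht'
      · simp only at i6
        omega

/-- The cost of treating a vector of rank one. -/
def rankOneCost (n d : ℕ) : ℕ := n * (1 + 2 * n) + n + krylovCost n d 1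

/-- At rank one W may grow to n columns and every vector may enter the basis, but orbits are single
vectors, so one vector costs only O(d n²). Nothing is put back, since a reduced vector is zero or
still of rank one. -/
lemma whileLoop_one {A : Matrix (Fin n) (Fin n) K}
    (vs : List (Orbit K n)) (st : State K n) (h : Reduced 1 st.cols)
    (hvs : ∀ v ∈ vs, v.length = 1) :
    (∃ bs, (whileLoop A d 1 vs st).value.B = st.B ++ bs ∧ bs.length ≤ vs.length ∧
        ∀ b ∈ bs, b.1 = 1) ∧
      (whileLoop A d 1 vs st).cost ≤ vs.length * rankOneCost n d := by
  induction vs generalizing st with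
  | nil => simp [whileLoop]
  | cons v vs ih =>
    obtain ⟨r1, r2, -, -, r5, r6⟩ := reduceBy_spec le_rfl h (hvs v (by simp))
    set u := (reduceBy st.cols v).value with hu
    obtain ⟨t1, t2, -, t4⟩ := trim_spec u
    set t := (trim u).value with ht
    rw [r1, one_mul] at t4
    have r6' : (reduceBy st.cols v).cost ≤ n * (1 + 2 * n) := by
      rw [one_mul] at r6
      exact r6.trans (Nat.mul_le_mul_right _ h.length_le)
    have hvs' : ∀ v ∈ vs, v.length = 1 := fun v hv => hvs v (by simp [hv])
    have hR : rankOneCost n d = n * (1 + 2 * n) + n + krylovCost n d 1 := rfl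
    simp only [whileLoop, value_bind, cost_bind, ← hu, ← ht, List.length_cons,
      Nat.succ_mul vs.length]
    by_cases h1 : t.length = 1
    · obtain ⟨w, hw⟩ := List.length_eq_one_iff.1 h1
      obtain ⟨a1, -, -, -, a5⟩ := addKrylov_spec (d := d) (A := A) le_rfl h h1
      simp only [if_pos h1]
      simp only [hw, List.getLast?_singleton, Option.map_some, Option.toList_some]
      rw [hw] at a1 a5
      by_cases hm : st.m - 1 = 0
      · simp only [hm, if_true, value_pure, cost_pure]
        exact ⟨⟨[(1, w)], rfl, by simp, by simp⟩, by omega⟩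
      · simp only [hm, if_false, value_bind, cost_bind]
        obtain ⟨⟨bs, i1, i2, i3⟩, i4⟩ := ih { st with
          B := st.B ++ [(1, w)]
          cols := (addKrylov A d st.cols [w]).value
          m := st.m - 1 } a1 hvs'
        refine ⟨⟨(1, w) :: bs, ?_, ?_, ?_⟩, ?_⟩
        · rw [i1, List.append_assoc, List.singleton_append]
        · simp only [List.length_cons]; omega
        · intro b hb
          rcases List.mem_cons.1 hb with rfl | hb
          · rfl
          · exact i3 b hb
        · omega
    · have h0 : t.length = 0 := by omega
      obtain ⟨⟨bs, i1, i2, i3⟩, i4⟩ := ih st h hvs'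
      simp only [h0, if_true, if_false, zero_ne_one]
      exact ⟨⟨bs, i1, by omega, i3⟩, by omega⟩

/-- The cost of the reductions of one vector at one rank above one. -/
def reductionCost (n d L : ℕ) : ℕ := d * (1 + L * (2 * n)) + L * n

/-- The number of waiting vectors never grows, because a treated vector returns at most once per
rank. Hypothesis `h2`, with its bound d on the number of columns, is needed only above rank one; at
rank one echelon form alone bounds the columns. -/
lemma forLoop_spec {A N : Matrix (Fin n) (Fin n) K} {L : ℕ} (l : ℕ) (hlL : l + 1 ≤ L)
    (st : State K n) (h : Reduced (l + 1) st.cols)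
    (hV : ∀ v ∈ st.V, IsOrbit N v ∧ 1 ≤ v.length ∧ v.length ≤ l + 1)
    (h2 : 1 ≤ l → (∀ c ∈ st.cols, IsOrbit N c.orbit) ∧ kerRange N ≤ colSpan st.cols ∧
      st.cols.length ≤ d) :
    (∃ bs, (forLoop A d (l + 1) st).value = st.B ++ bs ∧ bs.length ≤ st.V.length ∧
        ∀ b ∈ bs, b.1 = 1) ∧
      (forLoop A d (l + 1) st).cost ≤
        st.V.length * (l * reductionCost n d L + rankOneCost n d) := by
  induction l generalizing st with
  | zero =>
    have hfl : (st.V.filter fun v => v.length = 1).length ≤ st.V.length := List.length_filter_le _ _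
    obtain ⟨⟨bs, i1, i2, i3⟩, i4⟩ := whileLoop_one (A := A) (d := d)
      (st.V.filter fun v => v.length = 1)
      { st with V := st.V.filter fun v => v.length ≠ 1 } h (by simp)
    have hle : (st.V.filter fun v => v.length = 1).length * rankOneCost n d ≤
        st.V.length * rankOneCost n d := Nat.mul_le_mul_right _ hfl
    simp only [forLoop, zero_add, value_bind, cost_bind]
    split_ifs
    · simp only [value_pure, cost_pure, add_zero, zero_mul, zero_add]
      exact ⟨⟨bs, i1, i2.trans hfl, i3⟩, i4.trans hle⟩
    · simp only [value_pure, cost_pure, add_zero, zero_mul, zero_add]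
      exact ⟨⟨bs, i1, i2.trans hfl, i3⟩, i4.trans hle⟩
  | succ l ih =>
    obtain ⟨hcN, hspan, hcd⟩ := h2 (by omega)
    have hsum : (st.V.filter fun v => v.length = l + 1 + 1).length +
        (st.V.filter fun v => v.length ≠ l + 1 + 1).length = st.V.length := by
      simpa using (List.length_eq_length_filter_add (l := st.V)
        (fun v => decide (v.length = l + 1 + 1))).symm
    obtain ⟨i1, i2, ⟨ts, i3, i4, i5⟩, i6⟩ := whileLoop_of_two_le (A := A) (d := d) (N := N)
      (l := l + 1 + 1) (by omega) (st.V.filter fun v => v.length = l + 1 + 1)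
      { st with V := st.V.filter fun v => v.length ≠ l + 1 + 1 } h hcN hspan
      (fun v hv => by
        rw [List.mem_filter] at hv
        exact ⟨(hV v hv.1).1, by simpa using hv.2⟩)
    set W := whileLoop A d (l + 1 + 1) (st.V.filter fun v => v.length = l + 1 + 1)
      { st with V := st.V.filter fun v => v.length ≠ l + 1 + 1 } with hW
    have hred : st.cols.length * (1 + (l + 1 + 1) * (2 * n)) + (l + 1 + 1) * n ≤
        reductionCost n d L := by
      unfold reductionCost
      gcongr
    have hcost : W.cost ≤ st.V.length * reductionCost n d L :=
      i6.trans (Nat.mul_le_mul (by omega) hred)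
    have hVlen : W.value.V.length ≤ st.V.length := by
      rw [i3, List.length_append]
      simp only
      omega
    have hmul : W.value.V.length * (l * reductionCost n d L + rankOneCost n d) ≤
        st.V.length * (l * reductionCost n d L + rankOneCost n d) :=
      Nat.mul_le_mul_right _ hVlen
    have hdist : st.V.length * ((l + 1) * reductionCost n d L + rankOneCost n d) =
        st.V.length * reductionCost n d L +
          st.V.length * (l * reductionCost n d L + rankOneCost n d) := by ring
    rw [forLoop]
    simp only [value_bind, cost_bind, ← hW]
    by_cases hm : W.value.m = 0
    · simp only [hm, if_true, value_pure, cost_pure]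
      exact ⟨⟨[], by rw [i1, List.append_nil], by simp, by simp⟩, by omega⟩
    · simp only [hm, if_false]
      obtain ⟨hd1, hd2⟩ := h.map_dropLast (by omega)
      obtain ⟨⟨bs, j1, j2, j3⟩, j4⟩ := ih (by omega) { W.value with
          cols := W.value.cols.map (fun c => { c with orbit := c.orbit.dropLast }) }
        (by rw [i2]; exact hd1)
        (by
          intro v hv
          simp only at hv
          rw [i3, List.mem_append] at hv
          rcases hv with hv | hv
          · simp only [List.mem_filter] at hv
            obtain ⟨k1, k2, k3⟩ := hV v hv.1
            have : v.length ≠ l + 1 + 1 := by simpa using hv.2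
            exact ⟨k1, k2, by omega⟩
          · obtain ⟨k1, k2, k3⟩ := i5 v hv
            exact ⟨k1, k2, by omega⟩)
        (fun _ => by
          rw [i2]
          refine ⟨?_, by rw [hd2]; exact hspan, by simpa using hcd⟩
          intro c hc
          obtain ⟨c', hc', rfl⟩ := List.mem_map.1 hc
          exact (hcN c' hc').dropLast)
      simp only at j1 j2 j4
      exact ⟨⟨bs, by rw [j1, i1], j2.trans hVlen, j3⟩, by omega⟩

lemma krylovCost_mono {l L : ℕ} (h : l ≤ L) : krylovCost n d l ≤ krylovCost n d L := by
  unfold krylovCost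
  gcongr

lemma le_foldr_max {α : Type} (V : List (ℕ × α)) : ∀ v ∈ V, v.1 ≤ (V.map Prod.fst).foldr max 0 := by
  induction V with
  | nil => simp
  | cons w V ih =>
    intro v hv
    rcases List.mem_cons.1 hv with rfl | hv
    · simp
    · simpa using Or.inr (ih v hv)

/-- If every `A`-cyclic subspace of `ker N ∩ im N` is all of it, then the Jordan-Krylov basis consists
of one vector and of vectors of rank one, and it is computed at the stated cost. -/
lemma jordanKrylovBasis_spec {A N : Matrix (Fin n) (Fin n) K} {L r : ℕ} (hNA : Commute N A)
    (hcyc : ∀ x ∈ kerRange N, x ≠ 0 → ∀ W : Submodule K (Fin n → K),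
      (∀ j < d, (A ^ j).mulVec x ∈ W) → kerRange N ≤ W)
    (V : List (ℕ × (Fin n → K))) (m : ℕ) (hr : V.length ≤ r)
    (hV : ∀ v ∈ V, 1 ≤ v.1 ∧ v.1 ≤ L ∧ (N ^ v.1).mulVec v.2 = 0 ∧
      (N ^ (v.1 - 1)).mulVec v.2 ≠ 0) :
    ((jordanKrylovBasis A N d V m).value = [] ∨
      ∃ v bs, (jordanKrylovBasis A N d V m).value = v :: bs ∧ v.1 ≤ L ∧ bs.length ≤ r ∧
        ∀ b ∈ bs, b.1 = 1) ∧
      (jordanKrylovBasis A N d V m).cost ≤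
        L * (2 * n ^ 2) + krylovCost n d L + r * (L * (2 * n ^ 2)) +
          r * (L * reductionCost n d L + rankOneCost n d) := by
  have hmax := le_foldr_max V
  simp only [jordanKrylovBasis]
  set lmax := (V.map Prod.fst).foldr max 0 with hlmax
  rcases hF : V.filter (fun v => v.1 = lmax) with _ | ⟨v, vs⟩
  · rw [hF]
    simp
  · rw [hF]
    simp only
    have hmem : ∀ w ∈ v :: vs, w ∈ V ∧ w.1 = lmax := by
      intro w hw
      rw [← hF, List.mem_filter] at hw
      simpa using hw
    obtain ⟨hvV, hvl⟩ := hmem v (by simp)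
    obtain ⟨v1, v2, v3, v4⟩ := hV v hvV
    split_ifs with hm
    · refine ⟨Or.inr ⟨v, [], by simp, v2, by simp, by simp⟩, by simp⟩
    · rw [hvl] at v1 v2 v3 v4
      have hu := value_orbit N lmax v.2
      have huc := cost_orbit_le N lmax v.2
      have huN := isOrbit_iterate N lmax v.2 v3
      have htop : top (List.iterate N.mulVec v.2 lmax).reverse ≠ 0 := by
        obtain ⟨t, ht⟩ : ∃ t, lmax = t + 1 := ⟨lmax - 1, by omega⟩
        rw [ht, top_iterate]
        rwa [ht] at v4
      have hulen : (List.iterate N.mulVec v.2 lmax).reverse.length = lmax := by simp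
      obtain ⟨a1, a2, a3, a4, a5⟩ := addKrylov_spec (d := d) (A := A) v1 (Reduced.nil lmax) hulen
      set us := vs ++ V.filter (fun v => v.1 ≠ lmax) with hus
      have husV : ∀ w ∈ us, w ∈ V := by
        intro w hw
        rcases List.mem_append.1 hw with hw | hw
        · exact (hmem w (by simp [hw])).1
        · exact (List.mem_filter.1 hw).1
      have huslen : us.length ≤ V.length := by
        have h1 := List.length_eq_length_filter_add (l := V) (fun v => decide (v.1 = lmax))
        rw [hF] at h1
        simp at h1
        simp [hus]
        omega
      have hosc := cost_forEach_le (h := fun w : ℕ × (Fin n → K) => orbit N w.1 w.2) (xs := us)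
        (c := L * (2 * n ^ 2)) fun w hw => (cost_orbit_le N w.1 w.2).trans
          (Nat.mul_le_mul_right _ (hV w (husV w hw)).2.1)
      simp only [value_bind, cost_bind, hu, value_forEach, value_orbit]
      obtain ⟨t, ht⟩ : ∃ t, lmax = t + 1 := ⟨lmax - 1, by omega⟩
      set cols := (addKrylov A d [] (List.iterate N.mulVec v.2 lmax).reverse).value with hcols
      have hcN := a2 N hNA huN (by simp)
      obtain ⟨⟨bs, i1, i2, i3⟩, i4⟩ := forLoop_spec (A := A) (N := N) (d := d) (L := L) t
        (by omega) ⟨[v], cols, us.map fun w => (List.iterate N.mulVec w.2 w.1).reverse, m - lmax⟩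
        (by rw [← ht]; exact a1)
        (by
          intro o ho
          obtain ⟨w, hw, rfl⟩ := List.mem_map.1 ho
          obtain ⟨w1, w2, w3, w4⟩ := hV w (husV w hw)
          have := hmax w (husV w hw)
          exact ⟨isOrbit_iterate N w.1 w.2 w3, by simpa using w1, by simp; omega⟩)
        (by
          intro ht1
          -- For `lmax ≥ 2` the head of the first orbit is a nonzero element of ker N ∩ im N, so its
          -- d Krylov columns already span that space.
          refine ⟨hcN, hcyc _ (huN.top_mem_kerRange (by rw [hulen]; omega)) htop _ a3, ?_⟩
          simpa using a4)
      rw [← ht] at i1 i4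
      simp only [List.length_map] at i2 i4
      refine ⟨Or.inr ⟨v, bs, by rw [i1]; rfl, by omega, by omega, i3⟩, ?_⟩
      have hk : krylovCost n d lmax ≤ krylovCost n d L := krylovCost_mono v2
      have h1 : lmax * (2 * n ^ 2) ≤ L * (2 * n ^ 2) := Nat.mul_le_mul_right _ v2
      have h2 : us.length * (L * (2 * n ^ 2)) ≤ r * (L * (2 * n ^ 2)) :=
        Nat.mul_le_mul_right _ (by omega)
      have h3 : us.length * (t * reductionCost n d L + rankOneCost n d) ≤
          r * (L * reductionCost n d L + rankOneCost n d) := by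
        gcongr
        · omega
        · omega
      omega

end Loops

/-! ### Powers of ψ and the Jordan chains. -/

section Chains

variable {K : Type} [Field K] [DecidableEq K] {n d : ℕ}

@[simp] lemma cost_shiftAdd (f : Fin d → K) (z : K) (a x : Fin d → K) (c : K) :
    (shiftAdd f z a x c).cost = 4 * d := by
  simp [shiftAdd]; ring

lemma cost_mulModAux (f : Fin d → K) (z : K) (x : Fin d → K) (y : List K) :
    (mulModAux f z x y).cost = y.length * (4 * d) := by
  induction y with
  | nil => simp [mulModAux]
  | cons c cs ih => simp [mulModAux, ih]; ring

lemma cost_mulMod (f x y : Fin d → K) : (mulMod f x y).cost = d * (4 * d) := by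
  simp [mulMod, cost_mulModAux]

lemma length_addLists (p q : List (Fin d → K)) :
    (addLists p q).value.length = max p.length q.length := by
  induction p generalizing q with
  | nil => simp [addLists]
  | cons x xs ih =>
    cases q with
    | nil => simp [addLists]
    | cons y ys => simp [addLists, ih]

lemma cost_addLists_le (p q : List (Fin d → K)) : (addLists p q).cost ≤ p.length * d := by
  induction p generalizing q with
  | nil => simp [addLists]
  | cons x xs ih =>
    cases q with
    | nil => simp [addLists]
    | cons y ys =>
      have := ih ys
      simp [addLists, Nat.succ_mul xs.length]
      omega

lemma length_mulPoly_le (f : Fin d → K) (p q : List (Fin d → K)) :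
    (mulPoly f p q).value.length ≤ p.length + q.length := by
  induction p with
  | nil => simp [mulPoly]
  | cons c cs ih =>
    simp only [mulPoly, value_bind, length_addLists, value_forEach, List.length_map,
      List.length_cons]
    omega

lemma cost_mulPoly_le (f : Fin d → K) (p q : List (Fin d → K)) :
    (mulPoly f p q).cost ≤ p.length * (q.length * (d * (4 * d)) + q.length * d) := by
  induction p with
  | nil => simp [mulPoly]
  | cons c cs ih =>
    have h1 := cost_forEach_le (h := mulMod f c) (xs := q) (c := d * (4 * d))
      fun x _ => (cost_mulMod f c x).le
    have h2 := cost_addLists_le (forEach (mulMod f c) q).value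
      ((zeroVec d).value :: (mulPoly f cs q).value)
    rw [value_forEach, List.length_map] at h2
    simp only [mulPoly, cost_bind, value_forEach, cost_zeroVec, List.length_cons,
      Nat.succ_mul cs.length]
    omega

lemma length_psi (f : Fin d → K) : (psi f).value.length = d := by
  simp [psi]

lemma cost_psi (f : Fin d → K) : (psi f).cost = 0 := by
  simp [psi]

/-- Each factor ψ lengthens the coefficient list in μ by at most d; `a` counts the factors already
present. -/
lemma length_iterate_mulPoly_le (f : Fin d → K) (p q : List (Fin d → K)) (j a : ℕ)
    (hp : p.length = d) (hq : q.length ≤ a * d) :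
    ∀ x ∈ List.iterate (fun y => (mulPoly f p y).value) q j, x.length ≤ (a + j) * d := by
  induction j generalizing q a with
  | zero => simp
  | succ j ih =>
    intro x hx
    rw [List.iterate, List.mem_cons] at hx
    rcases hx with rfl | hx
    · exact hq.trans (Nat.mul_le_mul_right _ (by omega))
    · have := length_mulPoly_le f p q
      have h := ih (mulPoly f p q).value (a + 1) (by rw [Nat.succ_mul a]; omega) x hx
      rwa [show a + (j + 1) = a + 1 + j by ring]

lemma cost_iterates_mulPoly_le (f : Fin d → K) (p q : List (Fin d → K)) (j a : ℕ)
    (hp : p.length = d) (hq : q.length ≤ a * d) :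
    (iterates (mulPoly f p) j q).cost ≤ j * (d * ((a + j) * d * (4 * d ^ 2 + d))) := by
  induction j generalizing q a with
  | zero => simp [iterates]
  | succ j ih =>
    cases j with
    | zero => simp [iterates]
    | succ j =>
      have h1 := length_mulPoly_le f p q
      have h2 := cost_mulPoly_le f p q
      have h3 := ih (mulPoly f p q).value (a + 1) (by rw [Nat.succ_mul a]; omega)
      have h4 : p.length * (q.length * (d * (4 * d)) + q.length * d) ≤
          d * ((a + (j + 1 + 1)) * d * (4 * d ^ 2 + d)) := by
        rw [hp]
        calc d * (q.length * (d * (4 * d)) + q.length * d)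
            = d * (q.length * (4 * d ^ 2 + d)) := by ring
          _ ≤ _ := by
            gcongr
            exact hq.trans (Nat.mul_le_mul_right _ (by omega))
      rw [show a + 1 + (j + 1) = a + (j + 1 + 1) by ring] at h3
      simp only [iterates, cost_bind, cost_pure, add_zero]
      rw [Nat.succ_mul (j + 1)]
      omega

/-- The powers of `ψ` that are needed for vectors of rank at most `L`. -/
lemma psiPowers_spec (f : Fin d → K) (L : ℕ) :
    (∀ x ∈ (psiPowers f L).value, x.length ≤ (L + 1) * d) ∧
      (∀ x ∈ (psiPowers f L).value.take 1, x.length ≤ d) ∧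
      (psiPowers f L).value.length = L ∧
      (psiPowers f L).cost ≤ L * (d * ((L + 1) * d * (4 * d ^ 2 + d))) := by
  have hv : (psiPowers f L).value =
      List.iterate (fun y => (mulPoly f (psi f).value y).value) (psi f).value L := by
    simp [psiPowers]
  have hp := length_psi f
  rw [hv]
  refine ⟨?_, ?_, by simp, ?_⟩
  · rw [add_comm]
    exact length_iterate_mulPoly_le f _ _ L 1 hp (by rw [hp, one_mul])
  · cases L with
    | zero => simp
    | succ L => simp [hp]
  · simp only [psiPowers, cost_bind, cost_psi, zero_add]
    rw [add_comm L]
    exact cost_iterates_mulPoly_le f _ _ L 1 hp (by rw [hp, one_mul])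

lemma cost_evalPsi (A : Matrix (Fin n) (Fin n) K) (q : List (Fin d → K)) (b : Fin n → K) :
    (evalPsi A q b).cost = q.length * (2 * n ^ 2 + 2 * n * d) := by
  induction q generalizing b with
  | nil => simp [evalPsi]
  | cons c cs ih => simp [evalPsi, ih]; ring

lemma cost_jordanChain_le {A N : Matrix (Fin n) (Fin n) K} {c : ℕ} (qs : List (List (Fin d → K)))
    (hq : ∀ q ∈ qs, q.length ≤ c) (b : Fin n → K) :
    (jordanChain A N qs b).cost ≤
      qs.length * (c * (2 * n ^ 2 + 2 * n * d) + 2 * n ^ 2) := by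
  have he : ∀ q ∈ qs, ∀ b, (evalPsi A q b).cost ≤ c * (2 * n ^ 2 + 2 * n * d) := fun q hqs b => by
    rw [cost_evalPsi]
    exact Nat.mul_le_mul_right _ (hq q hqs)
  clear hq
  induction qs generalizing b with
  | nil => simp [jordanChain]
  | cons q qs ih =>
    have h1 := he q (by simp) b
    cases qs with
    | nil =>
      simp only [jordanChain, cost_bind, cost_pure, List.length_singleton, one_mul]
      omega
    | cons q' qs =>
      have h2 := ih (N.mulVec b) fun q'' h'' => he q'' (List.mem_cons_of_mem _ h'')
      rw [List.length_cons, Nat.succ_mul (q' :: qs).length]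
      simp only [jordanChain, cost_bind, cost_pure, value_matVec, cost_matVec, add_zero]
      omega

/-- The cost of the Jordan chains, if the Jordan-Krylov basis consists of one vector of rank at most
`L` and of at most `r` vectors of rank one. -/
lemma cost_jordanChains_le {A N : Matrix (Fin n) (Fin n) K} (f : Fin d → K)
    {B : List (ℕ × (Fin n → K))} {L r : ℕ} (hL : 1 ≤ L)
    (hB : B = [] ∨ ∃ v bs, B = v :: bs ∧ v.1 ≤ L ∧ bs.length ≤ r ∧ ∀ b ∈ bs, b.1 = 1) :
    (jordanChains A N f B).cost ≤
      L * (d * ((L + 1) * d * (4 * d ^ 2 + d))) +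
        L * ((L + 1) * d * (2 * n ^ 2 + 2 * n * d) + 2 * n ^ 2) +
        r * (d * (2 * n ^ 2 + 2 * n * d) + 2 * n ^ 2) := by
  have hM : (B.map Prod.fst).foldr max 0 ≤ L := by
    have hb : ∀ b ∈ B, b.1 ≤ L := by
      rcases hB with rfl | ⟨v, bs, rfl, h1, -, h2⟩
      · simp
      · intro b hb
        rcases List.mem_cons.1 hb with rfl | hb
        · exact h1
        · rw [h2 b hb]; exact hL
    clear hB
    induction B with
    | nil => simp
    | cons b B ih =>
      simpa using ⟨hb b (by simp), by simpa using ih fun b' hb' => hb b' (by simp [hb'])⟩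
  set M := (B.map Prod.fst).foldr max 0 with hMdef
  obtain ⟨p1, p2, p3, p4⟩ := psiPowers_spec f M
  have hc1 : (psiPowers f M).cost ≤ L * (d * ((L + 1) * d * (4 * d ^ 2 + d))) :=
    p4.trans (by gcongr)
  simp only [jordanChains, ← hMdef, cost_bind]
  set qs := (psiPowers f M).value with hqs
  rcases hB with rfl | ⟨v, bs, rfl, h1, h2, h3⟩
  · simp only [forEach, cost_pure]
    omega
  · have hv : (jordanChain A N (qs.take v.1).reverse v.2).cost ≤
        L * ((L + 1) * d * (2 * n ^ 2 + 2 * n * d) + 2 * n ^ 2) := by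
      refine (cost_jordanChain_le (c := (L + 1) * d) _ ?_ _).trans ?_
      · intro q hq
        refine (p1 q (List.mem_of_mem_take (List.mem_reverse.1 hq))).trans ?_
        gcongr
      · gcongr
        simp
        omega
    -- Vectors of rank one use only ψ itself, of length d; the general bound `(L + 1) * d` would
    -- cost a factor L too much here.
    have hb := cost_forEach_le (xs := bs)
      (h := fun b : ℕ × (Fin n → K) => jordanChain A N (qs.take b.1).reverse b.2)
      (c := d * (2 * n ^ 2 + 2 * n * d) + 2 * n ^ 2) (by
        intro b hb
        rw [h3 b hb]
        refine (cost_jordanChain_le (c := d) _ ?_ _).trans ?_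
        · intro q hq
          exact p2 q (List.mem_reverse.1 hq)
        · conv_rhs => rw [← one_mul (d * (2 * n ^ 2 + 2 * n * d) + 2 * n ^ 2)]
          gcongr
          simp)
    have hr : bs.length * (d * (2 * n ^ 2 + 2 * n * d) + 2 * n ^ 2) ≤
        r * (d * (2 * n ^ 2 + 2 * n * d) + 2 * n ^ 2) := Nat.mul_le_mul_right _ h2
    simp only [forEach, cost_bind, cost_pure]
    omega

end Chains

/-! ### The dimension of ker f(A) ∩ im f(A). -/

section Structure

lemma sum_C_mul_X_pow_eq_zero {K : Type} [Field K] {d : ℕ} {c : Fin d → K}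
    (h : ∑ b : Fin d, C (c b) * X ^ (b : ℕ) = (0 : K[X])) : c = 0 := by
  funext b
  have := congrArg (fun p => p.coeff b) h
  simpa [coeff_C_mul, coeff_X_pow, Fin.val_inj] using this

section Chain

variable {m : ℕ} {D : Matrix (Fin m) (Fin m) ℂ} {u : Fin m → ℂ} {l : ℕ}

/-- Only the constant term of `s` survives, since all higher terms contain D^(l+1). -/
lemma aeval_X_pow_mul_mulVec (hu : (D ^ (l + 1)).mulVec u = 0) (s : ℂ[X]) :
    (aeval D (X ^ l * s)).mulVec u = s.eval 0 • (D ^ l).mulVec u := by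
  obtain ⟨t, ht⟩ : X ∣ s - C (s.eval 0) := by
    rw [← sub_zero X, ← C_0, dvd_iff_isRoot]
    simp
  have hs : s = C (s.eval 0) + X * t := by rw [← ht]; ring
  have h1 : X ^ l * s = s.eval 0 • X ^ l + t * X ^ (l + 1) := by
    conv_lhs => rw [hs]
    rw [smul_eq_C_mul]
    ring
  rw [h1, map_add, map_smul, map_mul, map_pow, map_pow, aeval_X, Matrix.add_mulVec,
    Matrix.smul_mulVec, ← Matrix.mulVec_mulVec, hu, Matrix.mulVec_zero, add_zero]

/-- The annihilator of the generator of a chain of length l + 1 lies in (X^(l+1)): if p = X^j t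
annihilates u, multiplying by X^(l-j) isolates the constant term of t, which must vanish. -/
lemma X_pow_dvd_of_aeval_mulVec (hu : (D ^ (l + 1)).mulVec u = 0) (hne : (D ^ l).mulVec u ≠ 0)
    {p : ℂ[X]} (hp : (aeval D p).mulVec u = 0) {j : ℕ} (hj : j ≤ l + 1) : X ^ j ∣ p := by
  induction j with
  | zero => simp
  | succ j ih =>
    obtain ⟨t, rfl⟩ := ih (by omega)
    have h1 : X ^ l * t = X ^ (l - j) * (X ^ j * t) := by
      rw [← mul_assoc, ← pow_add, Nat.sub_add_cancel (by omega)]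
    have h2 := aeval_X_pow_mul_mulVec hu t
    rw [h1, map_mul, ← Matrix.mulVec_mulVec, hp, Matrix.mulVec_zero] at h2
    have h3 : t.eval 0 = 0 := (smul_eq_zero.1 h2.symm).resolve_right hne
    have h4 : X ∣ t := by
      rw [← sub_zero X, ← C_0, dvd_iff_isRoot]
      exact h3
    rw [pow_succ]
    exact mul_dvd_mul_left _ h4

/-- In the space spanned by a Jordan chain and by eigenvectors, the eigenvectors that are images under
`D` are multiples of the eigenvector of the chain. -/
lemma exists_smul_of_mem_span {k : ℕ} {w : Fin k → Fin m → ℂ}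
    (hu : (D ^ (l + 1)).mulVec u = 0) (hne : (D ^ l).mulVec u ≠ 0)
    (hw : ∀ j, D.mulVec (w j) = 0) {z : Fin m → ℂ}
    (hz : z ∈ Submodule.span ℂ (Set.range
      (Sum.elim (fun i : Fin (l + 1) => (D ^ (i : ℕ)).mulVec u) w)))
    (hDz : D.mulVec (D.mulVec z) = 0) : ∃ c : ℂ, D.mulVec z = c • (D ^ l).mulVec u := by
  -- The eigenvector part disappears under D, so the question reduces to the cyclic space of u.
  have hex : ∃ p : ℂ[X], ∃ v, z = (aeval D p).mulVec u + v ∧ D.mulVec v = 0 := by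
    clear hDz
    induction hz using Submodule.span_induction with
    | mem x hx =>
      obtain ⟨i | j, rfl⟩ := hx
      · exact ⟨X ^ (i : ℕ), 0, by simp, by simp⟩
      · exact ⟨0, w j, by simp, hw j⟩
    | zero => exact ⟨0, 0, by simp, by simp⟩
    | add x y _ _ hx hy =>
      obtain ⟨p, v, rfl, hv⟩ := hx
      obtain ⟨p', v', rfl, hv'⟩ := hy
      refine ⟨p + p', v + v', ?_, by rw [Matrix.mulVec_add, hv, hv', add_zero]⟩
      rw [map_add, Matrix.add_mulVec]
      abel
    | smul a x _ hx =>
      obtain ⟨p, v, rfl, hv⟩ := hx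
      refine ⟨a • p, a • v, ?_, by rw [Matrix.mulVec_smul, hv, smul_zero]⟩
      rw [map_smul, Matrix.smul_mulVec, smul_add]
  obtain ⟨p, v, rfl, hv⟩ := hex
  have h1 : D.mulVec ((aeval D p).mulVec u + v) = (aeval D (X * p)).mulVec u := by
    rw [Matrix.mulVec_add, hv, add_zero, map_mul, aeval_X, Matrix.mulVec_mulVec]
  rw [h1] at hDz ⊢
  have h2 : (aeval D (X * (X * p))).mulVec u = 0 := by
    rw [map_mul, aeval_X, ← Matrix.mulVec_mulVec, hDz]
  -- From X^(l+1) ∣ X · (X p) follows X^l ∣ X p, so D z is X^l s evaluated at D and applied to u.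
  have h3 := X_pow_dvd_of_aeval_mulVec hu hne h2 le_rfl
  rw [pow_succ'] at h3
  obtain ⟨s, hs⟩ := (mul_dvd_mul_iff_left X_ne_zero).1 h3
  exact ⟨s.eval 0, by rw [hs, aeval_X_pow_mul_mulVec hu]⟩

end Chain

variable {K : Type} [Field K] {n : ℕ}

/-- The coefficients, with respect to the powers of a root `α` of `f`, of the `i`-th entry of
`(f(A) / (A - α)) y`. -/
noncomputable def psiCoord (A : Matrix (Fin n) (Fin n) K) (f : K[X]) (i : Fin n) :
    (Fin n → K) →ₗ[K] (Fin f.natDegree → K) :=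
  LinearMap.pi fun b => ∑ a ∈ Finset.range f.natDegree,
    f.coeff (a + b + 1) • (LinearMap.proj i ∘ₗ (A ^ a).mulVecLin)

lemma psiCoord_apply (A : Matrix (Fin n) (Fin n) K) (f : K[X]) (i : Fin n) (y : Fin n → K)
    (b : Fin f.natDegree) : psiCoord A f i y b =
      ∑ a ∈ Finset.range f.natDegree, f.coeff (a + b + 1) * (A ^ a).mulVec y i := by
  simp [psiCoord]

/-- The coordinate of index d - 1 is the entry of y itself: only a = 0 contributes, with the leading
coefficient 1. -/
lemma eq_zero_of_psiCoord {A : Matrix (Fin n) (Fin n) K} {f : K[X]} (hf : f.Monic)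
    (hd : 0 < f.natDegree) {y : Fin n → K} (h : ∀ i, psiCoord A f i y = 0) : y = 0 := by
  funext i
  have h1 := congrFun (h i) ⟨f.natDegree - 1, by omega⟩
  rw [psiCoord_apply, Finset.sum_eq_single 0] at h1
  · have : 0 + (f.natDegree - 1) + 1 = f.natDegree := by omega
    rw [this, hf.coeff_natDegree] at h1
    simpa using h1
  · intro a _ ha
    rw [coeff_eq_zero_of_natDegree_lt (by simp only; omega), zero_mul]
  · intro h0
    exact absurd (Finset.mem_range.2 hd) h0

/-- If `ker f(A) ∩ im f(A)` has at most the dimension `deg f`, then it is generated, as a module over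
`K[A]`, by each of its nonzero elements. -/
lemma kerRange_le_of_pow_mulVec_mem {A : Matrix (Fin n) (Fin n) K} {f : K[X]} (hf : f.Monic)
    (hirr : Irreducible f) (hfr : Module.finrank K (kerRange (aeval A f)) ≤ f.natDegree)
    {x : Fin n → K} (hx : x ∈ kerRange (aeval A f)) (hx0 : x ≠ 0)
    {W : Submodule K (Fin n → K)} (hW : ∀ j < f.natDegree, (A ^ j).mulVec x ∈ W) :
    kerRange (aeval A f) ≤ W := by
  have hfx : (aeval A f).mulVec x = 0 := hx.1
  have hli : LinearIndependent K fun j : Fin f.natDegree => (A ^ (j : ℕ)).mulVec x := by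
    rw [Fintype.linearIndependent_iff]
    intro c hc
    refine congrFun (sum_C_mul_X_pow_eq_zero ?_)
    by_contra h3
    set p := ∑ b : Fin f.natDegree, C (c b) * X ^ (b : ℕ) with hp
    have hpx : (aeval A p).mulVec x = 0 := by
      rw [hp, map_sum, Matrix.sum_mulVec, ← hc]
      refine Finset.sum_congr rfl fun b _ => ?_
      rw [← smul_eq_C_mul, map_smul, map_pow, aeval_X, Matrix.smul_mulVec]
    have hnd : ¬ f ∣ p := by
      refine hf.not_dvd_of_degree_lt h3 ?_
      rw [degree_eq_natDegree hf.ne_zero]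
      exact degree_sum_fin_lt _
    -- The Bézout relation, applied to x, which both polynomials annihilate, would give x = 0.
    obtain ⟨a, b, hab⟩ := (hirr.coprime_iff_not_dvd).2 hnd
    have h1 := congrArg (fun s => (aeval A s).mulVec x) hab
    simp only [map_add, map_mul, map_one, Matrix.add_mulVec, ← Matrix.mulVec_mulVec, hfx, hpx,
      Matrix.mulVec_zero, add_zero, Matrix.one_mulVec] at h1
    exact hx0 h1.symm
  have hle : Submodule.span K (Set.range fun j : Fin f.natDegree => (A ^ (j : ℕ)).mulVec x) ≤
      kerRange (aeval A f) := by
    rw [Submodule.span_le]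
    rintro _ ⟨j, rfl⟩
    have hcomm : Commute (aeval A f) (A ^ (j : ℕ)) := by
      have := Commute.map (Commute.all f (X ^ (j : ℕ))) (aeval A)
      simpa using this
    obtain ⟨-, z, rfl⟩ := hx
    refine ⟨?_, (A ^ (j : ℕ)).mulVec z, ?_⟩
    · change (aeval A f).mulVec _ = 0
      rw [Matrix.mulVec_mulVec, hcomm.eq, ← Matrix.mulVec_mulVec, hfx, Matrix.mulVec_zero]
    · simp only [Matrix.mulVecLin_apply]
      rw [Matrix.mulVec_mulVec, Matrix.mulVec_mulVec, hcomm.eq]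
  rw [← Submodule.eq_of_le_of_finrank_le hle
    (by rw [finrank_span_eq_card hli, Fintype.card_fin]; exact hfr), Submodule.span_le]
  rintro _ ⟨j, rfl⟩
  exact hW j j.2

variable [Algebra K ℂ]

lemma coeff_divByMonic_eq_sum (f : K[X]) (α : ℂ) (a : ℕ) :
    (f.map (algebraMap K ℂ) /ₘ (X - C α)).coeff a =
      ∑ b : Fin f.natDegree, α ^ (b : ℕ) * algebraMap K ℂ (f.coeff (a + b + 1)) := by
  rw [coeff_divByMonic_X_sub_C, natDegree_map, Fin.sum_univ_eq_sum_range
    (fun b => α ^ b * algebraMap K ℂ (f.coeff (a + b + 1)))]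
  rw [show Finset.Icc (a + 1) f.natDegree = Finset.Ico (a + 1) (f.natDegree + 1) from by
    ext; simp, Finset.sum_Ico_eq_sum_range]
  refine Finset.sum_subset_zero_on_sdiff (fun x hx => ?_) (fun b hb => ?_) (fun b _ => ?_)
  · simp only [Finset.mem_range] at hx ⊢
    omega
  · simp only [Finset.mem_sdiff, Finset.mem_range] at hb
    rw [coeff_eq_zero_of_natDegree_lt (by omega), map_zero, mul_zero]
  · rw [Nat.add_sub_cancel_left, coeff_map, show a + 1 + b = a + b + 1 by ring]

lemma map_mulVec_pow (A : Matrix (Fin n) (Fin n) K) (a : ℕ) (y : Fin n → K) (i : Fin n) :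
    (A.map (algebraMap K ℂ) ^ a).mulVec (algebraMap K ℂ ∘ y) i =
      algebraMap K ℂ ((A ^ a).mulVec y i) := by
  rw [RingHom.map_mulVec, Matrix.map_pow]

lemma map_mulVec_aeval (A : Matrix (Fin n) (Fin n) K) (f : K[X]) (y : Fin n → K) :
    (aeval (A.map (algebraMap K ℂ)) (f.map (algebraMap K ℂ))).mulVec (algebraMap K ℂ ∘ y) =
      algebraMap K ℂ ∘ (aeval A f).mulVec y := by
  have h : aeval (A.map (algebraMap K ℂ)) (f.map (algebraMap K ℂ)) =
      (aeval A f).map (algebraMap K ℂ) := by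
    rw [aeval_map_algebraMap]
    exact aeval_algHom_apply ((Algebra.ofId K ℂ).mapMatrix) A f
  rw [h]
  funext i
  exact (RingHom.map_mulVec (algebraMap K ℂ) _ _ i).symm

/-- The quotient f(μ) / (μ - α) is ψ(μ, α); sorting it by powers of α separates the complex number
from data over K. -/
lemma aeval_divByMonic_mulVec (A : Matrix (Fin n) (Fin n) K) {f : K[X]}
    (hd : 0 < f.natDegree) (α : ℂ) (y : Fin n → K) (i : Fin n) :
    (aeval (A.map (algebraMap K ℂ)) (f.map (algebraMap K ℂ) /ₘ (X - C α))).mulVec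
        (algebraMap K ℂ ∘ y) i =
      ∑ b : Fin f.natDegree, α ^ (b : ℕ) * algebraMap K ℂ (psiCoord A f i y b) := by
  have hdeg : (f.map (algebraMap K ℂ) /ₘ (X - C α)).natDegree < f.natDegree := by
    rw [natDegree_divByMonic _ (monic_X_sub_C α), natDegree_map, natDegree_X_sub_C]
    omega
  rw [aeval_eq_sum_range' hdeg, Matrix.sum_mulVec, Finset.sum_apply]
  simp only [Matrix.smul_mulVec, Pi.smul_apply, map_mulVec_pow, coeff_divByMonic_eq_sum,
    psiCoord_apply, map_sum, map_mul, smul_eq_mul, Finset.sum_mul, Finset.mul_sum]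
  rw [Finset.sum_comm]
  refine Finset.sum_congr rfl fun b _ => Finset.sum_congr rfl fun a _ => by ring

/-- If for a root `α` of `f` the generalized eigenspace is spanned by one Jordan chain and by
eigenvectors, then `ker f(A) ∩ im f(A)` has at most the dimension `deg f`. -/
lemma finrank_kerRange_le {A : Matrix (Fin n) (Fin n) K} {f : K[X]} {l k : ℕ} (hf : f.Monic)
    (hirr : Irreducible f) (hl : 1 ≤ l) {α : ℂ} (hα : aeval α f = 0)
    (h : HasOneChainAndEigenvectors (A.map (algebraMap K ℂ)) α l k) :
    Module.finrank K (kerRange (aeval A f)) ≤ f.natDegree := by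
  obtain ⟨u, w, hu, hw, hli, hspan⟩ := h
  obtain ⟨l, rfl⟩ : ∃ t, l = t + 1 := ⟨l - 1, by omega⟩
  set B := A.map (algebraMap K ℂ) with hB
  set D := B - Matrix.scalar (Fin n) α with hD
  have hd := hirr.natDegree_pos
  have hne : (D ^ l).mulVec u ≠ 0 := by
    simpa using hli.ne_zero (Sum.inl (Fin.last l))
  have hDw : ∀ j, D.mulVec (w j) = 0 := by
    intro j
    rw [hD, Matrix.sub_mulVec, hw j, Matrix.scalar_apply, Matrix.diagonal_const_mulVec, sub_self]
  have hDX : aeval B (X - C α) = D := by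
    rw [map_sub, aeval_X, aeval_C]
    rfl
  set F := f.map (algebraMap K ℂ) with hF
  set q := F /ₘ (X - C α) with hq
  have hFq : (X - C α) * q = F := by
    rw [hq, mul_divByMonic_eq_iff_isRoot, IsRoot.def, hF, eval_map_algebraMap, hα]
  have hsmul : ∀ y ∈ kerRange (aeval A f), ∃ c : ℂ,
      (aeval B q).mulVec (algebraMap K ℂ ∘ y) = c • (D ^ l).mulVec u := by
    rintro _ ⟨hy, x, rfl⟩
    have hy' : (aeval A f).mulVec ((aeval A f).mulVec x) = 0 := hy
    -- With y = f(A) x and f = (X - α) q, one has q(A) y = D q(A)² x.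
    have h1 : D.mulVec ((aeval B (q * q)).mulVec (algebraMap K ℂ ∘ x)) =
        (aeval B q).mulVec (algebraMap K ℂ ∘ (aeval A f).mulVec x) := by
      rw [← map_mulVec_aeval, ← hDX, Matrix.mulVec_mulVec, Matrix.mulVec_mulVec, ← map_mul,
        ← map_mul, ← hF, ← hFq]
      congr 2
      ring
    have h2 : D.mulVec (D.mulVec ((aeval B (q * q)).mulVec (algebraMap K ℂ ∘ x))) = 0 := by
      rw [h1, ← hDX, Matrix.mulVec_mulVec, ← map_mul, hFq, map_mulVec_aeval, hy']
      funext i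
      simp
    rw [Matrix.mulVecLin_apply, ← h1]
    refine exists_smul_of_mem_span hu hne hDw ?_ h2
    rw [hspan, Module.End.mem_maxGenEigenspace]
    -- The vector q(A)² x is killed by D², hence belongs to the generalized eigenspace.
    refine ⟨2, ?_⟩
    have h3 : Matrix.toLin' B - α • (1 : Module.End ℂ (Fin n → ℂ)) = Matrix.toLin' D := by
      rw [hD, map_sub]
      congr 1
      ext v
      simp [Matrix.scalar_apply, Pi.single_apply]
    rw [h3, pow_two, Module.End.mul_apply, Matrix.toLin'_apply, Matrix.toLin'_apply, h2]
  obtain ⟨i, hi⟩ := Function.ne_iff.1 hne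
  -- At index `i` the end of the chain is nonzero. Vanishing coordinates there give c = 0, hence
  -- q(A) y = 0; independence of the powers of α then kills the coordinates at all other indices.
  have hinj : Function.Injective ((psiCoord A f i).domRestrict (kerRange (aeval A f))) := by
    rw [← LinearMap.ker_eq_bot, LinearMap.ker_eq_bot']
    rintro ⟨y, hy⟩ h0
    have h0' : psiCoord A f i y = 0 := h0
    obtain ⟨c, hc⟩ := hsmul y hy
    have h1 := aeval_divByMonic_mulVec A hd α y i
    rw [← hB, ← hF, ← hq, hc, h0'] at h1
    have hc0 : c = 0 := by
      simpa using (mul_eq_zero.1 (show c * (D ^ l).mulVec u i = 0 by simpa using h1)).resolve_right hi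
    rw [Subtype.ext_iff]
    refine eq_zero_of_psiCoord (A := A) hf hd fun i' => ?_
    have h2 := aeval_divByMonic_mulVec A hd α y i'
    rw [← hB, ← hF, ← hq, hc, hc0, zero_smul] at h2
    refine sum_C_mul_X_pow_eq_zero ?_
    by_contra h3
    have h4 : aeval α (∑ b : Fin f.natDegree, C (psiCoord A f i' y b) * X ^ (b : ℕ)) = 0 := by
      rw [map_sum, ← Pi.zero_apply (M := fun _ : Fin n => ℂ) i', h2]
      refine Finset.sum_congr rfl fun b _ => ?_
      rw [map_mul, aeval_C, map_pow, aeval_X, mul_comm]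
    refine hf.not_dvd_of_degree_lt h3 ?_ ?_
    · rw [degree_eq_natDegree hf.ne_zero]
      exact degree_sum_fin_lt _
    · exact (minpoly.eq_of_irreducible_of_monic hirr hα hf).dvd.trans (minpoly.dvd K α h4)
  simpa using LinearMap.finrank_le_finrank_of_injective hinj

end Structure

/-! ### Numerical estimates and the final bound. -/

/-- The sum of the costs of the parts of the algorithm. -/
lemma total_cost_le {n d l r M : ℕ} (hd : 1 ≤ d) (hl : 1 ≤ l) (hdl : d * l ≤ n) (hdM : d ≤ M)
    (hlM : l ≤ M) (hrM : r ≤ M) :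
    n * ((l + 1) * (2 * d * (n + 1) + d)) + r * (2 * n ^ 2) +
      (l * (2 * n ^ 2) + krylovCost n d l + r * (l * (2 * n ^ 2)) +
        r * (l * reductionCost n d l + rankOneCost n d)) +
      (l * (d * ((l + 1) * d * (4 * d ^ 2 + d))) +
        l * ((l + 1) * d * (2 * n ^ 2 + 2 * n * d) + 2 * n ^ 2) +
        r * (d * (2 * n ^ 2 + 2 * n * d) + 2 * n ^ 2)) ≤
      62 * (d * n ^ 2 * l * M) := by
  have hdn : d ≤ n := (Nat.le_mul_of_pos_right d hl).trans hdl
  have hln : l ≤ n := (Nat.le_mul_of_pos_left l hd).trans hdl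
  have hn : 1 ≤ n := hd.trans hdn
  have hM : 1 ≤ M := hd.trans hdM
  have hnn : n ≤ n ^ 2 := Nat.le_self_pow two_ne_zero n
  have hd1 : n ^ 2 ≤ d * n ^ 2 := Nat.le_mul_of_pos_left _ hd
  have hl1 : d * n ^ 2 ≤ d * n ^ 2 * l := Nat.le_mul_of_pos_right _ hl
  have e1 : d * n ^ 2 * l ≤ d * n ^ 2 * l * M := Nat.le_mul_of_pos_right _ hM
  have e2 : d * n ^ 2 * l * r ≤ d * n ^ 2 * l * M := Nat.mul_le_mul_left _ hrM
  have e3 : d * n ^ 2 * l * l ≤ d * n ^ 2 * l * M := Nat.mul_le_mul_left _ hlM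
  have e4 : d * n ^ 2 * l * d ≤ d * n ^ 2 * l * M := Nat.mul_le_mul_left _ hdM
  have hnd : 2 * n ^ 2 + 2 * n * d ≤ 4 * n ^ 2 := by
    calc 2 * n ^ 2 + 2 * n * d ≤ 2 * n ^ 2 + 2 * n * n := by gcongr
      _ = 4 * n ^ 2 := by ring
  have b1 : n * ((l + 1) * (2 * d * (n + 1) + d)) ≤ 10 * (d * n ^ 2 * l) := by
    calc n * ((l + 1) * (2 * d * (n + 1) + d)) ≤ n * ((l + l) * (2 * d * (n + n) + d * n)) := by
          gcongr
          exact Nat.le_mul_of_pos_right d hn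
      _ = 10 * (d * n ^ 2 * l) := by ring
  have b2 : r * (2 * n ^ 2) ≤ 2 * (d * n ^ 2 * l * r) := by
    calc r * (2 * n ^ 2) ≤ r * (2 * (d * n ^ 2 * l)) := by gcongr; omega
      _ = 2 * (d * n ^ 2 * l * r) := by ring
  have b3 : l * (2 * n ^ 2) ≤ 2 * (d * n ^ 2 * l) := by
    calc l * (2 * n ^ 2) ≤ l * (2 * (d * n ^ 2)) := by gcongr
      _ = 2 * (d * n ^ 2 * l) := by ring
  have b4 : krylovCost n d l ≤ 6 * (d * n ^ 2 * l) := by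
    calc krylovCost n d l ≤ d * (l * (2 * n ^ 2)) + d * (n * (l * n + l * (2 * n)) + l * n ^ 2) := by
          unfold krylovCost
          gcongr
          · exact Nat.mul_pos hl hn
          · exact hnn.trans (Nat.le_mul_of_pos_left _ hl)
      _ = 6 * (d * n ^ 2 * l) := by ring
  have b5 : r * (l * (2 * n ^ 2)) ≤ 2 * (d * n ^ 2 * l * r) := by
    calc r * (l * (2 * n ^ 2)) ≤ r * (l * (2 * (d * n ^ 2))) := by gcongr
      _ = 2 * (d * n ^ 2 * l * r) := by ring
  -- Here d l ≤ n absorbs the orbit length together with the number of columns.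
  have b6 : reductionCost n d l ≤ 4 * (d * n ^ 2) := by
    calc reductionCost n d l ≤ d * (l * n + l * (2 * n)) + n * n := by
          unfold reductionCost
          gcongr
          exact Nat.mul_pos hl hn
      _ = 3 * (d * l * n) + n ^ 2 := by ring
      _ ≤ 3 * (n * n) + n ^ 2 := by gcongr
      _ = 4 * n ^ 2 := by ring
      _ ≤ 4 * (d * n ^ 2) := by gcongr
  have b7 : rankOneCost n d ≤ 10 * (d * n ^ 2 * l) := by
    have h1 : krylovCost n d 1 ≤ 6 * (d * n ^ 2) := by
      calc krylovCost n d 1 ≤ d * (2 * n ^ 2) + d * (n * (n + 2 * n) + n ^ 2) := by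
            unfold krylovCost
            simp only [one_mul]
            gcongr
        _ = 6 * (d * n ^ 2) := by ring
    have h2 : n * (1 + 2 * n) ≤ 3 * n ^ 2 := by
      calc n * (1 + 2 * n) ≤ n * (n + 2 * n) := by gcongr
        _ = 3 * n ^ 2 := by ring
    unfold rankOneCost
    omega
  have b8 : r * (l * reductionCost n d l + rankOneCost n d) ≤ 14 * (d * n ^ 2 * l * r) := by
    calc r * (l * reductionCost n d l + rankOneCost n d)
        ≤ r * (l * (4 * (d * n ^ 2)) + 10 * (d * n ^ 2 * l)) := by gcongr
      _ = 14 * (d * n ^ 2 * l * r) := by ring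
  -- The square (d l)² ≤ n² turns d⁴ l² into d² n².
  have b9 : l * (d * ((l + 1) * d * (4 * d ^ 2 + d))) ≤ 10 * (d * n ^ 2 * l * d) := by
    calc l * (d * ((l + 1) * d * (4 * d ^ 2 + d)))
        ≤ l * (d * ((l + l) * d * (4 * d ^ 2 + d ^ 2))) := by
          gcongr
          exact Nat.le_self_pow two_ne_zero d
      _ = 10 * (d * (d * l) ^ 2 * 1 * d) := by ring
      _ ≤ 10 * (d * n ^ 2 * l * d) := by gcongr
  have b10 : l * ((l + 1) * d * (2 * n ^ 2 + 2 * n * d) + 2 * n ^ 2) ≤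
      10 * (d * n ^ 2 * l * l) := by
    calc l * ((l + 1) * d * (2 * n ^ 2 + 2 * n * d) + 2 * n ^ 2)
        ≤ l * ((l + l) * d * (4 * n ^ 2) + 2 * (d * n ^ 2 * l)) := by
          gcongr
          omega
      _ = 10 * (d * n ^ 2 * l * l) := by ring
  have b11 : r * (d * (2 * n ^ 2 + 2 * n * d) + 2 * n ^ 2) ≤ 6 * (d * n ^ 2 * l * r) := by
    calc r * (d * (2 * n ^ 2 + 2 * n * d) + 2 * n ^ 2)
        ≤ r * (d * (4 * n ^ 2) + 2 * (d * n ^ 2)) := by gcongr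
      _ = 6 * (d * n ^ 2 * r) := by ring
      _ ≤ 6 * (d * n ^ 2 * l * r) := by gcongr
  omega

end JordanKrylov

theorem mainTheorem5 :
    ∃ C : ℕ, ∀ (K : Type) [Field K] [Algebra K ℂ] [DecidableEq K]
      (n l k : ℕ) (A : Matrix (Fin n) (Fin n) K) (f g : Polynomial K)
      -- the basis, the minimal annihilating polynomials `P i = f ^ (lv i) * ge i`,
      -- the given matrices `ge i (A)`, and the subroutine that calculates `f(A)`
      (E : Module.Basis (Fin n) K (Fin n → K)) (P ge : Fin n → Polynomial K) (lv : Fin n → ℕ)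
      (G : Fin n → Matrix (Fin n) (Fin n) K)
      (calcfA : JordanKrylov.Arith K (Matrix (Fin n) (Fin n) K)),
      f.Monic → Irreducible f → 1 ≤ l → ¬ f ∣ g →
      A.charpoly = f ^ (l + k) * g →
      minpoly K A = f ^ l * g →
      (∀ α : ℂ, Polynomial.aeval α f = 0 →
        JordanKrylov.HasOneChainAndEigenvectors (A.map (algebraMap K ℂ)) α l k) →
      Squarefree g →
      (∀ i, JordanKrylov.IsMinimalAnnihilating A (E i) (P i)) →
      (∀ i, P i = f ^ lv i * ge i ∧ ¬ f ∣ ge i) →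
      (∀ i, G i = Polynomial.aeval A (ge i)) →
      calcfA.value = Polynomial.aeval A f →
      (JordanKrylov.generalizedEigenspace (d := f.natDegree) calcfA
        { A := A
          f := fun j => f.coeff j
          E := fun i => E i
          P := fun i => JordanKrylov.coeffList (P i)
          G := G
          m := l + k }).cost ≤
        calcfA.cost + C * (f.natDegree * n ^ 2 * l *
          max f.natDegree (max l (Set.ncard {i : Fin n | f ∣ P i}))) := by
  -- 62 = 10 + 2 + 2 + 6 + 2 + 14 + 10 + 10 + 6, the constants of `b1` to `b5` and `b8` to `b11` in
  -- `total_cost_le`.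
  refine ⟨62, ?_⟩
  intro K _ _ _ n l k A f g E P ge lv G calcfA hf hirr hl hfg hchar hmin hchain _ hP hPg hG hfA
  have hd := hirr.natDegree_pos
  have hA0 : A.charpoly ≠ 0 := (Matrix.charpoly_monic A).ne_zero
  have hcd : A.charpoly.natDegree = n := by simp [Matrix.charpoly_natDegree_eq_dim]
  have hPmin : ∀ i, P i ∣ minpoly K A := fun i => ((hP i).2 _).1 (by simp)
  have hPn : ∀ i, (P i).natDegree ≤ n := fun i => by
    rw [← hcd]
    exact natDegree_le_of_dvd ((hPmin i).trans (Matrix.minpoly_dvd_charpoly A)) hA0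
  -- A larger exponent would make f^(l+1) divide f^l g, contrary to `f ∤ g`.
  have hlv : ∀ i, lv i ≤ l := by
    intro i
    have h1 : f ^ lv i ∣ f ^ l * g :=
      (Dvd.intro _ (hPg i).1.symm).trans (hmin ▸ hPmin i)
    by_contra hlt
    have h2 : f ^ l * f ∣ f ^ l * g := by
      rw [← pow_succ]
      exact (pow_dvd_pow f (by omega)).trans h1
    exact hfg ((mul_dvd_mul_iff_left (pow_ne_zero l hf.ne_zero)).1 h2)
  have hdl : f.natDegree * l ≤ n := by
    have h1 : f ^ l ∣ A.charpoly := by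
      rw [hchar, pow_add, mul_assoc]
      exact dvd_mul_right _ _
    have h2 := natDegree_le_of_dvd h1 hA0
    rwa [natDegree_pow, hcd, mul_comm] at h2
  -- The chain structure at a single root suffices, since irreducibility transfers it to the
  -- K-dimension of ker f(A) ∩ im f(A).
  obtain ⟨α, hα⟩ := IsAlgClosed.exists_aeval_eq_zero ℂ f
    (by rw [degree_eq_natDegree hf.ne_zero]; exact_mod_cast hd.ne')
  have hfr := JordanKrylov.finrank_kerRange_le hf hirr hl hα (hchain α hα)
  set r := Set.ncard {i : Fin n | f ∣ P i} with hr
  set inp : JordanKrylov.Input K n f.natDegree :=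
    { A := A
      f := fun j => f.coeff j
      E := fun i => E i
      P := fun i => JordanKrylov.coeffList (P i)
      G := G
      m := l + k } with hinp
  obtain ⟨k1, k2, k3⟩ := JordanKrylov.krylovGenerators_spec (inp := inp) (A := A) (l := l) hf hirr
    rfl (fun _ => rfl) hG hP hPn (fun i => (hPg i).1) (fun i => (hPg i).2) hlv
  rw [← hr] at k1 k2
  have hcomm : Commute (aeval A f) A := by
    have := Commute.map (Commute.all f X) (aeval A)
    simpa using this
  obtain ⟨j1, j2⟩ := JordanKrylov.jordanKrylovBasis_spec (d := f.natDegree) (L := l) (r := r) hcomm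
    (fun x hx hx0 W hW => JordanKrylov.kerRange_le_of_pow_mulVec_mem hf hirr hfr hx hx0 hW)
    (JordanKrylov.krylovGenerators inp).value (l + k) k1 k3
  have hc := JordanKrylov.cost_jordanChains_le (A := A) (N := aeval A f)
    (fun j : Fin f.natDegree => f.coeff j) hl j1
  have htot := JordanKrylov.total_cost_le hd hl hdl (le_max_left f.natDegree (max l r))
    ((le_max_left l r).trans (le_max_right f.natDegree _))
    ((le_max_right l r).trans (le_max_right f.natDegree _))
  simp only [JordanKrylov.generalizedEigenspace, JordanKrylov.Arith.cost_bind, hfA]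
  change _ + (_ + ((JordanKrylov.jordanKrylovBasis A (aeval A f) f.natDegree
    (JordanKrylov.krylovGenerators inp).value (l + k)).cost +
    (JordanKrylov.jordanChains A (aeval A f) (fun j : Fin f.natDegree => f.coeff j)
      (JordanKrylov.jordanKrylovBasis A (aeval A f) f.natDegree
        (JordanKrylov.krylovGenerators inp).value (l + k)).value).cost)) ≤ _
  omega
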